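/- Let $N\ge 2$, let $F_N$ be the free group with basis $A_N=\{a_0,\dots,a_{N-1}\}$, whose elements are written as reduced words, let $\partial F_N$ be the set of infinite reduced words (with the topology of pointwise convergence of letters), and let $\partial^2F_N=(\partial F_N\times\partial F_N)\setminus\Delta$. An automorphism $\psi$ of $F_N$ induces $\partial\psi$ on $\partial F_N$ and $\partial^2\psi$ on $\partial^2F_N$, and $i_w(u)=w^{-1}uw$. We write $u*v$ for a product without cancellation, and $\epsilon$ for the empty word. Let $S(X,Y)=(Y_0^{-1}X,Y_0^{-1}Y)$, where $Y_0$ is the first letter of $Y$; its inverse, on pairs with distinct first letters, is $S^{-1}(X,Y)=(X_0^{-1}X,X_0^{-1}Y)$. Let $\varphi$ be an automorphism of $F_N$ that is $A_N$-positive (for $a\in A_N$, all letters of $\varphi(a)$ are in $A_N$) and primitive (there is $k\ge1$ such that every letter of $A_N$ occurs in $\varphi^k(a)$ for every $a\in A_N$). Its attracting subshift $\Sigma_\varphi$ is the closure of the orbit $\{S^n(X,Y):n\in\mathbb Z\}$, where $a\in A_N$ and $k\ge1$ are such that $\varphi^k(a)=p*a*s$ with $p,s\neq\epsilon$, and $X=\lim_n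 p^{-1}\varphi^k(p^{-1})\cdots\varphi^{nk}(p^{-1})$, $Y=\lim_n a\,s\,\varphi^k(s)\cdots\varphi^{nk}(s)$ (it does not depend on the choice of $a$ and $k$). The prefix-suffix development $\rho_\varphi(W)=(p_i,a_i,s_i)_{i\ge0}$ of $W\in\Sigma_\varphi$ is the sequence of triples in $F_N\times A_N\times F_N$ for which there are points $W=W_{(0)},W_{(1)},W_{(2)},\dots$ of $\Sigma_\varphi$ such that, for every $i\ge 0$, the second coordinate of $W_{(i)}$ starts with $a_i$, $\varphi(a_{i+1})=p_i*a_i*s_i$ and $W_{(i)}=S^{|p_i|}(\partial^2\varphi(W_{(i+1)}))$. Let $(p,a,s)^*$ denote the infinite repetition of $(p,a,s)$. Finally, for $u=u_0u_1\cdots u_m\in F_N$ let $$\gamma_{\varphi_-}(u)=\varphi(u_m)u_0\cdots u_{m-1},\qquad \gamma_{\varphi_+}(u)=u_1\cdots u_m\varphi(u_0),\qquad \gamma_{\varphi_\pm}(\epsilon)=\epsilon .$$ **Theorem.** Let $W\in\Sigma_\varphi$ be such that $\rho_\varphi(W)=(p_i,a_i,s_i)_{0\le i<n}(p,a,s)^*$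 for some $n\ge 0$ and $\rho_\varphi(S^j(W))=(p,a,s)^*$ for some integer $j$. Then $W$ is a fixed point of $\partial^2(i_w\circ\varphi)^h$ for some integer $h\ge1$ and some $w \in F_N$ such that 1. if $j\ge0$, then $w=\gamma_{\varphi_-}^{\,j}(p)$; 2. if $j<0$, then $w^{-1}=\gamma_{\varphi_+}^{\,|j|-1}(s)$. -/

import Mathlib

open Filter Topology

namespace PrefixSuffix

/-- `F N` is the free group on the basis `a_0, …, a_{N-1}`. Its elements are identified with reduced
words through `FreeGroup.toWord`; the letter `(i, true)` is `a_i` and `(i, false)` is `a_i⁻¹`. -/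
abbrev F (N : ℕ) : Type := FreeGroup (Fin N)

/-- Letters: elements of the basis and their inverses. -/
abbrev Letter (N : ℕ) : Type := Fin N × Bool

/-- The inverse of a letter. -/
def invLetter {N : ℕ} (x : Letter N) : Letter N := (x.1, !x.2)

theorem invLetter_invLetter {N : ℕ} (x : Letter N) : invLetter (invLetter x) = x := by
  simp [invLetter]

/-- The boundary of the free group: infinite reduced words, with the topology of pointwise
convergence of letters. -/
abbrev Boundary (N : ℕ) : Type :=
  {X : ℕ → Letter N // ∀ i, X (i + 1) ≠ invLetter (X i)}

/-- The finite word formed by the first `n` letters of a boundary point. -/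
def Boundary.pre {N : ℕ} (X : Boundary N) (n : ℕ) : F N :=
  FreeGroup.mk ((List.range n).map X.1)

/-- A sequence of elements of the free group converges to a boundary point: every letter of the
reduced words is eventually the corresponding letter of the boundary point. -/
def ConvergesTo {N : ℕ} (g : ℕ → F N) (X : Boundary N) : Prop :=
  ∀ i, ∀ᶠ n in atTop, (g n).toWord[i]? = some (X.1 i)

theorem ConvergesTo.unique {N : ℕ} {g : ℕ → F N} {X Y : Boundary N}
    (hX : ConvergesTo g X) (hY : ConvergesTo g Y) : X = Y := by
  apply Subtype.ext
  funext i
  obtain ⟨n, h1, h2⟩ := ((hX i).and (hY i)).exists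
  rw [h1] at h2
  exact Option.some.inj h2

theorem ConvergesTo.take {N : ℕ} {g : ℕ → F N} {X : Boundary N} (hX : ConvergesTo g X) (k : ℕ) :
    ∀ᶠ n in atTop, (g n).toWord.take k = (List.range k).map X.1 := by
  have h : ∀ᶠ n in atTop, ∀ i ∈ Finset.range k, (g n).toWord[i]? = some (X.1 i) :=
    (eventually_all_finset _).2 fun i _ => hX i
  filter_upwards [h] with n hn
  apply List.ext_getElem?
  intro i
  by_cases hi : i < k
  · rw [List.getElem?_take_of_lt hi, hn i (Finset.mem_range.2 hi)]
    simp [hi]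
  · simp [hi]

theorem Boundary.toWord_pre {N : ℕ} (X : Boundary N) (n : ℕ) :
    (X.pre n).toWord = (List.range n).map X.1 := by
  rw [Boundary.pre, FreeGroup.toWord_mk]
  apply FreeGroup.IsReduced.reduce_eq
  rw [FreeGroup.IsReduced, List.isChain_iff_getElem]
  intro i hi
  simp only [List.length_map, List.length_range] at hi
  simp only [List.getElem_map, List.getElem_range]
  intro h1
  by_contra h2
  apply X.2 i
  apply Prod.ext
  · exact h1.symm
  · simp only [invLetter]
    revert h2
    cases (X.1 i).2 <;> cases (X.1 (i + 1)).2 <;> simp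

theorem Boundary.norm_pre {N : ℕ} (X : Boundary N) (n : ℕ) : (X.pre n).norm = n := by
  simp [FreeGroup.norm, X.toWord_pre n]

theorem Boundary.pre_succ {N : ℕ} (X : Boundary N) (n : ℕ) :
    X.pre (n + 1) = X.pre n * FreeGroup.mk [X.1 n] := by
  simp [Boundary.pre, List.range_succ, FreeGroup.mul_mk]

theorem norm_le_add {N : ℕ} (g h : F N) : g.norm ≤ h.norm + (h⁻¹ * g).norm := by
  simpa using FreeGroup.norm_mul_le h (h⁻¹ * g)

theorem take_mul_letter {N : ℕ} (g : F N) (x : Letter N) (k : ℕ) (hk : k + 1 ≤ g.norm) :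
    (g * FreeGroup.mk [x]).toWord.take k = g.toWord.take k := by
  by_cases hr : FreeGroup.IsReduced (g.toWord ++ [x])
  · have : (g * FreeGroup.mk [x]).toWord = g.toWord ++ [x] := by
      conv_lhs => rw [← FreeGroup.mk_toWord (x := g), FreeGroup.mul_mk, FreeGroup.toWord_mk]
      exact hr.reduce_eq
    rw [this, List.take_append_of_le_length]
    exact le_trans (Nat.le_succ k) hk
  · have hne : g.toWord ≠ [] := by
      intro h
      simp [FreeGroup.norm, h] at hk
    obtain ⟨l, y, hl⟩ : ∃ l y, g.toWord = l ++ [y] :=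
      ⟨g.toWord.dropLast, g.toWord.getLast hne, (List.dropLast_append_getLast hne).symm⟩
    have hg : FreeGroup.IsReduced (l ++ [y]) := hl ▸ FreeGroup.isReduced_toWord
    have hy : y.1 = x.1 ∧ y.2 = !x.2 := by
      by_contra hcon
      apply hr
      have := FreeGroup.IsReduced.append_overlap (L₁ := l) (L₂ := [y]) (L₃ := [x]) hg
        (by
          simp only [List.singleton_append, FreeGroup.isReduced_cons_cons,
            FreeGroup.IsReduced.singleton, and_true]
          intro h1
          by_contra h2
          apply hcon
          refine ⟨h1, ?_⟩
          revert h2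
          cases y.2 <;> cases x.2 <;> simp) (by simp)
      rwa [hl]
    have hyx : FreeGroup.mk [y] * FreeGroup.mk [x] = (1 : F N) := by
      obtain ⟨y1, y2⟩ := y
      obtain ⟨x1, x2⟩ := x
      obtain ⟨h1, h2⟩ := hy
      simp only at h1 h2
      subst h1 h2
      have : (FreeGroup.mk [(y1, !x2)] : F N) = (FreeGroup.mk [(y1, x2)])⁻¹ := by
        simp [FreeGroup.inv_mk, FreeGroup.invRev]
      rw [this, inv_mul_cancel]
    have hgx : g * FreeGroup.mk [x] = FreeGroup.mk l := by
      conv_lhs => rw [← FreeGroup.mk_toWord (x := g), hl, ← FreeGroup.mul_mk, mul_assoc, hyx]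
      simp
    have hlr : FreeGroup.IsReduced l := hg.infix ⟨[], [y], by simp⟩
    rw [hgx, FreeGroup.toWord_mk, hlr.reduce_eq, hl, List.take_append_of_le_length]
    have : g.norm = l.length + 1 := by simp [FreeGroup.norm, hl]
    omega

theorem take_mul {N : ℕ} (l : List (Letter N)) : ∀ (g : F N) (k : ℕ), k + l.length ≤ g.norm →
    (g * FreeGroup.mk l).toWord.take k = g.toWord.take k := by
  induction l with
  | nil => intro g k _; simp [← FreeGroup.one_eq_mk]
  | cons x l ih =>
    intro g k hk
    simp only [List.length_cons] at hk
    have h1 : FreeGroup.mk (x :: l) = FreeGroup.mk [x] * (FreeGroup.mk l : F N) := by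
      simp [FreeGroup.mul_mk]
    have h2 := norm_le_add g (g * FreeGroup.mk [x])
    have h3 : ((g * FreeGroup.mk [x])⁻¹ * g).norm ≤ 1 := by
      have : (g * FreeGroup.mk [x])⁻¹ * g = (FreeGroup.mk [x])⁻¹ := by group
      rw [this, FreeGroup.norm_inv_eq]
      exact FreeGroup.norm_mk_le
    rw [h1, ← mul_assoc, ih _ _ (by omega), take_mul_letter _ _ _ (by omega)]

/-- Nearby long words have a long common prefix. -/
theorem take_eq_of_norm {N : ℕ} (g h : F N) (k L : ℕ) (hL : (g⁻¹ * h).norm ≤ L)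
    (hk : k + L ≤ g.norm) : h.toWord.take k = g.toWord.take k := by
  have := take_mul (g⁻¹ * h).toWord g k (by simp only [FreeGroup.norm] at *; omega)
  rwa [FreeGroup.mk_toWord, mul_inv_cancel_left] at this

theorem exists_norm_bound {N : ℕ} (ψ : MulAut (F N)) :
    ∃ K, ∀ g : F N, (ψ g).norm ≤ K * g.norm := by
  refine ⟨∑ a : Fin N, (ψ (FreeGroup.of a)).norm, fun g => ?_⟩
  have key : ∀ l : List (Letter N), (ψ (FreeGroup.mk l)).norm ≤
      (∑ a : Fin N, (ψ (FreeGroup.of a)).norm) * l.length := by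
    intro l
    induction l with
    | nil => simp [← FreeGroup.one_eq_mk]
    | cons x l ih =>
      have h1 : FreeGroup.mk (x :: l) = FreeGroup.mk [x] * (FreeGroup.mk l : F N) := by
        simp [FreeGroup.mul_mk]
      have h2 : (ψ (FreeGroup.mk [x])).norm = (ψ (FreeGroup.of x.1)).norm := by
        obtain ⟨a, b⟩ := x
        cases b
        · have : (FreeGroup.mk [(a, false)] : F N) = (FreeGroup.of a)⁻¹ := by
            simp [FreeGroup.of, FreeGroup.inv_mk, FreeGroup.invRev]
          rw [this, map_inv, FreeGroup.norm_inv_eq]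
        · rfl
      have h3 : (ψ (FreeGroup.of x.1)).norm ≤ ∑ a : Fin N, (ψ (FreeGroup.of a)).norm :=
        Finset.single_le_sum (f := fun a => (ψ (FreeGroup.of a)).norm)
          (fun _ _ => Nat.zero_le _) (Finset.mem_univ _)
      rw [h1, map_mul, List.length_cons, mul_add, mul_one]
      refine (FreeGroup.norm_mul_le _ _).trans ?_
      omega
  simpa [FreeGroup.norm, FreeGroup.mk_toWord] using key g.toWord

theorem exists_convergesTo {N : ℕ} (g : ℕ → F N) (L : ℕ)
    (hL : ∀ n, ((g n)⁻¹ * g (n + 1)).norm ≤ L) (hg : Tendsto (fun n => (g n).norm) atTop atTop) :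
    ∃ X : Boundary N, ConvergesTo g X := by
  have h1 : ∀ i : ℕ, ∃ x : Letter N, ∀ᶠ n in atTop, (g n).toWord[i]? = some x := by
    intro i
    obtain ⟨n₀, hn₀⟩ := eventually_atTop.1 (hg.eventually_ge_atTop (i + 1 + L))
    have hlt : i < (g n₀).toWord.length := by
      have := hn₀ n₀ le_rfl
      simp only [FreeGroup.norm] at this
      omega
    refine ⟨(g n₀).toWord[i], eventually_atTop.2 ⟨n₀, fun n hn => ?_⟩⟩
    have h2 : (g n).toWord.take (i + 1) = (g n₀).toWord.take (i + 1) := by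
      induction n, hn using Nat.le_induction with
      | base => rfl
      | succ n hn ih => rw [← ih, take_eq_of_norm (g n) (g (n + 1)) _ L (hL n) (hn₀ n hn)]
    have h3 := congrArg (fun l => l[i]?) h2
    simp only [List.getElem?_take_of_lt (Nat.lt_succ_self i)] at h3
    rw [h3, List.getElem?_eq_getElem hlt]
  choose X hX using h1
  refine ⟨⟨X, fun i hi => ?_⟩, hX⟩
  obtain ⟨n, h2, h3⟩ := ((hX i).and (hX (i + 1))).exists
  have hr := FreeGroup.isReduced_toWord (x := g n)
  rw [FreeGroup.IsReduced, List.isChain_iff_getElem] at hr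
  obtain ⟨hl3, h3'⟩ := List.getElem?_eq_some_iff.1 h3
  obtain ⟨hl2, h2'⟩ := List.getElem?_eq_some_iff.1 h2
  have := hr i hl3
  rw [h2', h3', hi] at this
  simp [invLetter] at this

theorem norm_step {N : ℕ} (ψ : MulAut (F N)) {K : ℕ} (hK : ∀ g : F N, (ψ g).norm ≤ K * g.norm)
    (X : Boundary N) (n : ℕ) : ((ψ (X.pre n))⁻¹ * ψ (X.pre (n + 1))).norm ≤ K := by
  rw [X.pre_succ, map_mul, inv_mul_cancel_left]
  calc _ ≤ K * (FreeGroup.mk [X.1 n]).norm := hK _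
    _ ≤ K * 1 := Nat.mul_le_mul_left _ FreeGroup.norm_mk_le
    _ = K := mul_one K

/-- The images of the prefixes of a boundary point under an automorphism converge. -/
theorem exists_convergesTo_map {N : ℕ} (ψ : MulAut (F N)) (X : Boundary N) :
    ∃ Y : Boundary N, ConvergesTo (fun n => ψ (X.pre n)) Y := by
  obtain ⟨K, hK⟩ := exists_norm_bound ψ
  obtain ⟨M, hM⟩ := exists_norm_bound ψ⁻¹
  refine exists_convergesTo _ K (norm_step ψ hK X) ?_
  rw [tendsto_atTop]
  intro b
  filter_upwards [eventually_ge_atTop (M * b + 1)] with n hn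
  have h1 := hM (ψ (X.pre n))
  rw [MulAut.inv_apply_self, X.norm_pre] at h1
  by_contra hlt
  have := Nat.mul_le_mul_left M (not_le.1 hlt).le
  omega

/-- The map `∂ψ` induced on the boundary by an automorphism `ψ`: the extension by continuity
`∂ψ (X) = lim ψ (X_0 ⋯ X_{n-1})`. -/
noncomputable def boundaryMap {N : ℕ} (ψ : MulAut (F N)) (X : Boundary N) : Boundary N :=
  (exists_convergesTo_map ψ X).choose

theorem boundaryMap_spec {N : ℕ} (ψ : MulAut (F N)) (X : Boundary N) :
    ConvergesTo (fun n => ψ (X.pre n)) (boundaryMap ψ X) :=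
  (exists_convergesTo_map ψ X).choose_spec

theorem exists_near {N : ℕ} (ψ : MulAut (F N)) {K : ℕ} (hK : ∀ g : F N, (ψ g).norm ≤ K * g.norm)
    (X : Boundary N) (k : ℕ) :
    ∃ n, (((boundaryMap ψ X).pre (k + 1))⁻¹ * ψ (X.pre n)).norm ≤ K ∧
      k + 1 ≤ (ψ (X.pre n)).norm := by
  classical
  set Z := boundaryMap ψ X with hZ
  have hex := eventually_atTop.1 ((boundaryMap_spec ψ X).take (k + 1))
  have h0 : Nat.find hex ≠ 0 := by
    intro h
    have := Nat.find_spec hex 0 (by omega)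
    simp only [Boundary.pre, List.range_zero, List.map_nil, ← FreeGroup.one_eq_mk, map_one,
      FreeGroup.toWord_one, List.take_nil] at this
    simpa using congrArg List.length this
  obtain ⟨m, hm⟩ := Nat.exists_eq_succ_of_ne_zero h0
  have h1 := Nat.find_spec hex
  rw [hm] at h1
  have h2 := Nat.find_min hex (m := m) (by omega)
  have hg1 : (ψ (X.pre (m + 1))).toWord.take (k + 1) = (List.range (k + 1)).map Z.1 :=
    h1 (m + 1) le_rfl
  have hg0 : (ψ (X.pre m)).toWord.take (k + 1) ≠ (List.range (k + 1)).map Z.1 := by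
    intro h
    apply h2
    intro b hb
    rcases hb.eq_or_lt with rfl | hb
    · exact h
    · exact h1 b hb
  have hlen : (ψ (X.pre (m + 1))).norm < k + 1 + K := by
    by_contra hcon
    apply hg0
    rw [← hg1]
    refine take_eq_of_norm _ _ _ K ?_ (not_lt.1 hcon)
    rw [← FreeGroup.norm_inv_eq]
    simpa using norm_step ψ hK X m
  have hdec : ψ (X.pre (m + 1)) =
      Z.pre (k + 1) * FreeGroup.mk ((ψ (X.pre (m + 1))).toWord.drop (k + 1)) := by
    have h5 : Z.pre (k + 1) = FreeGroup.mk ((ψ (X.pre (m + 1))).toWord.take (k + 1)) := by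
      rw [hg1, Boundary.pre]
    rw [h5, FreeGroup.mul_mk, List.take_append_drop, FreeGroup.mk_toWord]
  have hk1 : k + 1 ≤ (ψ (X.pre (m + 1))).norm := by
    have := congrArg List.length hg1
    simp only [List.length_take, List.length_map, List.length_range] at this
    simp only [FreeGroup.norm]
    omega
  refine ⟨m + 1, ?_, hk1⟩
  have h3 : (Z.pre (k + 1))⁻¹ * ψ (X.pre (m + 1)) =
      FreeGroup.mk ((ψ (X.pre (m + 1))).toWord.drop (k + 1)) :=
    inv_mul_eq_iff_eq_mul.2 hdec
  rw [h3]
  refine FreeGroup.norm_mk_le.trans ?_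
  simp only [FreeGroup.norm] at hlen
  simp only [List.length_drop]
  omega

theorem boundaryMap_injective {N : ℕ} (ψ : MulAut (F N)) :
    Function.Injective (boundaryMap ψ) := by
  intro X Y hXY
  apply Subtype.ext
  funext c
  obtain ⟨K, hK⟩ := exists_norm_bound ψ
  obtain ⟨M, hM⟩ := exists_norm_bound ψ⁻¹
  set k := K * (c + 1 + M * (K + K)) with hk
  obtain ⟨n, hn1, hn2⟩ := exists_near ψ hK X k
  obtain ⟨m, hm1, -⟩ := exists_near ψ hK Y k
  rw [← hXY] at hm1
  set Z := (boundaryMap ψ X).pre (k + 1) with hZ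
  have h1 : ((X.pre n)⁻¹ * Y.pre m).norm ≤ M * (K + K) := by
    have h2 := hM ((Z⁻¹ * ψ (X.pre n))⁻¹ * (Z⁻¹ * ψ (Y.pre m)))
    have h3 : ψ⁻¹ ((Z⁻¹ * ψ (X.pre n))⁻¹ * (Z⁻¹ * ψ (Y.pre m))) = (X.pre n)⁻¹ * Y.pre m := by
      rw [mul_inv_rev, inv_inv, mul_assoc, mul_inv_cancel_left, map_mul, map_inv,
        MulAut.inv_apply_self, MulAut.inv_apply_self]
    rw [h3] at h2
    refine h2.trans (Nat.mul_le_mul_left M ((FreeGroup.norm_mul_le _ _).trans ?_))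
    rw [FreeGroup.norm_inv_eq]
    omega
  have hn : c + 1 + M * (K + K) ≤ n := by
    by_contra hcon
    have h2 := hK (X.pre n)
    rw [X.norm_pre] at h2
    have := Nat.mul_le_mul_left K (not_le.1 hcon).le
    omega
  have h4 := take_eq_of_norm (X.pre n) (Y.pre m) (c + 1) _ h1 (by rw [X.norm_pre]; exact hn)
  rw [X.toWord_pre, Y.toWord_pre] at h4
  have h5 := congrArg (fun l => l[c]?) h4
  simp only [List.getElem?_take_of_lt (Nat.lt_succ_self c), List.getElem?_map] at h5
  rw [List.getElem?_range (show c < n by omega)] at h5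
  by_cases hcm : c < m
  · rw [List.getElem?_range hcm] at h5
    simpa using h5.symm
  · rw [List.getElem?_eq_none (by simpa using hcm)] at h5
    simp at h5

/-- Left multiplication of a boundary point by a letter `x`: the first letter is removed if it is
`x⁻¹`, and `x` is put in front otherwise. -/
def letterMul {N : ℕ} (x : Letter N) (X : Boundary N) : Boundary N :=
  if h : X.1 0 = invLetter x then ⟨fun i => X.1 (i + 1), fun i => X.2 (i + 1)⟩
  else ⟨fun i => Nat.casesOn i x X.1, fun i => by
    cases i with
    | zero => exact h
    | succ i => exact X.2 i⟩

theorem letterMul_invLetter {N : ℕ} (x : Letter N) (X : Boundary N) :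
    letterMul (invLetter x) (letterMul x X) = X := by
  apply Subtype.ext
  funext i
  by_cases h : X.1 0 = invLetter x
  · have h1 : X.1 1 ≠ x := by
      have := X.2 0
      rwa [h, invLetter_invLetter] at this
    cases i with
    | zero => simp [letterMul, h, h1, invLetter_invLetter]
    | succ i => simp [letterMul, h, h1, invLetter_invLetter]
  · simp [letterMul, h, invLetter_invLetter]

theorem letterMul_injective {N : ℕ} (x : Letter N) : Function.Injective (letterMul x) :=
  Function.LeftInverse.injective (letterMul_invLetter x)

/-- The double boundary: pairs of distinct boundary points. -/
abbrev DoubleBoundary (N : ℕ) : Type :=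
  {Z : Boundary N × Boundary N // Z.1 ≠ Z.2}

/-- The map `∂²ψ` induced on the double boundary by an automorphism. -/
noncomputable def doubleBoundaryMap {N : ℕ} (ψ : MulAut (F N)) (Z : DoubleBoundary N) :
    DoubleBoundary N :=
  ⟨(boundaryMap ψ Z.1.1, boundaryMap ψ Z.1.2), fun h => Z.2 (boundaryMap_injective ψ h)⟩

/-- Left multiplication of a point of the double boundary by a letter. -/
def letterMul₂ {N : ℕ} (x : Letter N) (Z : DoubleBoundary N) : DoubleBoundary N :=
  ⟨(letterMul x Z.1.1, letterMul x Z.1.2), fun h => Z.2 (letterMul_injective x h)⟩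

/-- The shift `S (X, Y) = (Y_0⁻¹ X, Y_0⁻¹ Y)`. -/
def shift {N : ℕ} (Z : DoubleBoundary N) : DoubleBoundary N :=
  letterMul₂ (invLetter (Z.1.2.1 0)) Z

/-- The inverse shift `S⁻¹ (X, Y) = (X_0⁻¹ X, X_0⁻¹ Y)`. It inverts `shift` on the pairs whose
coordinates have different first letters, in particular on the attracting subshift. -/
def shiftInv {N : ℕ} (Z : DoubleBoundary N) : DoubleBoundary N :=
  letterMul₂ (invLetter (Z.1.1.1 0)) Z

theorem letterMul_invLetter' {N : ℕ} (x : Letter N) (X : Boundary N) :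
    letterMul x (letterMul (invLetter x) X) = X := by
  simpa [invLetter_invLetter] using letterMul_invLetter (invLetter x) X

theorem shift_shiftInv {N : ℕ} (Z : DoubleBoundary N) (h : Z.1.1.1 0 ≠ Z.1.2.1 0) :
    shift (shiftInv Z) = Z := by
  have h1 : (shiftInv Z).1.2.1 0 = invLetter (Z.1.1.1 0) := by
    simp [shiftInv, letterMul₂, letterMul, invLetter_invLetter, h.symm]
  apply Subtype.ext
  rw [shift, h1, invLetter_invLetter]
  simp [shiftInv, letterMul₂, letterMul_invLetter']

theorem shiftInv_shift {N : ℕ} (Z : DoubleBoundary N) (h : Z.1.1.1 0 ≠ Z.1.2.1 0) :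
    shiftInv (shift Z) = Z := by
  have h1 : (shift Z).1.1.1 0 = invLetter (Z.1.2.1 0) := by
    simp [shift, letterMul₂, letterMul, invLetter_invLetter, h]
  apply Subtype.ext
  rw [shiftInv, h1, invLetter_invLetter]
  simp [shift, letterMul₂, letterMul_invLetter']

/-- The powers `S^j`, for `j` an integer. -/
def shiftPow {N : ℕ} (j : ℤ) (Z : DoubleBoundary N) : DoubleBoundary N :=
  if 0 ≤ j then shift^[j.natAbs] Z else shiftInv^[j.natAbs] Z

/-- A word is pure positive: it is not empty and all its letters are in the basis. -/
def IsPurePositive {N : ℕ} (v : F N) : Prop :=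
  v ≠ 1 ∧ ∀ x ∈ v.toWord, x.2 = true

/-- An automorphism is positive (with respect to the basis). -/
def IsPositive {N : ℕ} (φ : MulAut (F N)) : Prop :=
  ∀ a : Fin N, IsPurePositive (φ (FreeGroup.of a))

/-- A positive automorphism is primitive if for some `k ≥ 1`, every letter of the basis is a letter
of `φ^k (a)` for every `a` in the basis. -/
def IsPrimitive {N : ℕ} (φ : MulAut (F N)) : Prop :=
  ∃ k : ℕ, 1 ≤ k ∧ ∀ a b : Fin N, (b, true) ∈ ((φ ^ k) (FreeGroup.of a)).toWord

/-- `v = p * a * s` without cancellation, where `a` is an element of the basis. -/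
def FactorsAs {N : ℕ} (v p : F N) (a : Fin N) (s : F N) : Prop :=
  v.toWord = p.toWord ++ (a, true) :: s.toWord

/-- `Z = (X, Y)` is a bi-infinite word generating the attracting subshift: for some letter `a` and
some `k` with `φ^k (a) = p * a * s`, where `p` and `s` are not empty,
`X = lim p⁻¹ φ^k(p⁻¹) ⋯ φ^{nk}(p⁻¹)` and `Y = lim a s φ^k(s) ⋯ φ^{nk}(s)`. -/
def IsGenerator {N : ℕ} (φ : MulAut (F N)) (Z : DoubleBoundary N) : Prop :=
  ∃ (a : Fin N) (k : ℕ) (p s : F N), p ≠ 1 ∧ s ≠ 1 ∧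
    FactorsAs ((φ ^ k) (FreeGroup.of a)) p a s ∧
    ConvergesTo (fun n => ((List.range (n + 1)).map fun i => (φ ^ (i * k)) p⁻¹).prod) Z.1.1 ∧
    ConvergesTo (fun n => FreeGroup.of a *
      ((List.range (n + 1)).map fun i => (φ ^ (i * k)) s).prod) Z.1.2

/-- The attracting subshift `Σ_φ`: the closure of the `S`-orbit of a generator. For a positive
primitive automorphism all generators yield the same set, so that this union is over equal sets. -/
def attractingSubshift {N : ℕ} (φ : MulAut (F N)) : Set (DoubleBoundary N) :=
  ⋃ Z ∈ {Z : DoubleBoundary N | IsGenerator φ Z}, closure (Set.range fun j : ℤ => shiftPow j Z)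

/-- Triples `(p, a, s)`, the labels of the prefix-suffix automaton. -/
abbrev Label (N : ℕ) : Type := F N × Fin N × F N

/-- Admissible developments: `(p_i, a_i, s_i)_{i ≥ 0}` is the sequence of labels of an infinite walk
in the prefix-suffix automaton, which has an edge labeled `(p, a, s)` from `a` to `b` when
`φ (b) = p * a * s`. -/
def IsAdmissible {N : ℕ} (φ : MulAut (F N)) (d : ℕ → Label N) : Prop :=
  ∀ i, FactorsAs (φ (FreeGroup.of (d (i + 1)).2.1)) (d i).1 (d i).2.1 (d i).2.2

/-- The graph of the prefix-suffix development map: `HasDevelopment φ W d` says that `W` is a point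
of the attracting subshift and `ρ_φ (W) = d`. The development `(p_i, a_i, s_i)_{i ≥ 0}` of `W` is
obtained by successive desubstitutions: there are points `W = Z_0, Z_1, Z_2, …` of the attracting
subshift such that `Z_i = S^{|p_i|} (∂²φ (Z_{i+1}))`, where the second coordinate of `Z_i` starts
with `a_i`, and `φ (a_{i+1}) = p_i * a_i * s_i` for all `i`. -/
def HasDevelopment {N : ℕ} (φ : MulAut (F N)) (W : DoubleBoundary N) (d : ℕ → Label N) : Prop :=
  IsAdmissible φ d ∧ ∃ Z : ℕ → DoubleBoundary N, Z 0 = W ∧ ∀ i,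
    Z i ∈ attractingSubshift φ ∧ (Z i).1.2.1 0 = ((d i).2.1, true) ∧
    Z i = shift^[(d i).1.norm] (doubleBoundaryMap φ (Z (i + 1)))

/-- The inner automorphism `i_w (u) = w⁻¹ u w`. -/
def innerAut {N : ℕ} (w : F N) : MulAut (F N) := MulAut.conj w⁻¹

theorem innerAut_apply {N : ℕ} (w u : F N) : innerAut w u = w⁻¹ * u * w := by
  simp [innerAut]

/-- `u_0 ⋯ u_p ↦ φ(u_p) u_0 ⋯ u_{p-1}` (the empty word is sent to itself). -/
def gammaMinus {N : ℕ} (φ : MulAut (F N)) (u : F N) : F N :=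
  φ (FreeGroup.mk u.toWord.getLast?.toList) * FreeGroup.mk u.toWord.dropLast

/-- `u_0 ⋯ u_p ↦ u_1 ⋯ u_p φ(u_0)` (the empty word is sent to itself). -/
def gammaPlus {N : ℕ} (φ : MulAut (F N)) (u : F N) : F N :=
  FreeGroup.mk u.toWord.tail * φ (FreeGroup.mk u.toWord.head?.toList)

end PrefixSuffix

open PrefixSuffix

/-! Conjugation by `c` acts on the boundary as left multiplication by `c`, so shifts and
desubstitutions are all actions of automorphisms. As `p_i` is a prefix of the second coordinate of
`∂²φ(W_(i+1))`, a development says `W_(i) = p_i⁻¹ ∂²φ(W_(i+1))`. Write `V = S^j W = k W`, where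
`k⁻¹` is read off one half of `W`.

The desubstitutions of `V` form a backward orbit of `T ↦ p⁻¹ ∂φ(T)`. Each half of a point of the
subshift has letters of a single sign. First letters range over a finite set, and since `φ` expands,
the first letter far along the orbit determines a long prefix. Hence the orbit is periodic
(`exists_periodic_of_signed`, `exists_pow_fixed_of_const`) and `V` is fixed by a power of `i_p ∘ φ`.
Transport by `k` gives the claim for `W`, with `w⁻¹ = k⁻¹ p⁻¹ φ(k)`.

It remains to recognise this word. By `gammaPlus_iterate`, `v⁻¹ q φ(v)` is an iterate of `gammaPlus`
at `q` as soon as `v` is a prefix of `q φ(q) φ²(q) ⋯`. So `k` should be a prefix of `p⁻¹ φ(p⁻¹) ⋯`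
if `j ≥ 0`, and `a` followed by a prefix of `s φ(s) ⋯` if `j < 0`. Both follow from
`devWord_eq_of_eventually_const`. The `i`-th desubstitutions of `V` and `W` differ by a word `k_i`
of a single sign, and `φ^m(k_{n+m})` is conjugate to `k_n`, hence of the same length. Growth then
forces `k_n = 1`. -/

namespace PrefixSuffix

/-! ### Automorphisms acting on the boundary; shifts as conjugations. -/

section BoundaryAction

variable {N : ℕ}

theorem norm_mk_of_isReduced {l : List (Letter N)} (h : FreeGroup.IsReduced l) :
    (FreeGroup.mk l : F N).norm = l.length := by
  rw [FreeGroup.norm, FreeGroup.toWord_mk, h.reduce_eq]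

/-- Each further letter moves the image by at most `K`, while the lower bound on the length keeps
the norm of the image above `i + K`. The first `i` letters are therefore out of reach of
cancellation. -/
theorem take_map_append (ψ : MulAut (F N)) {K M : ℕ} (hK : ∀ g : F N, (ψ g).norm ≤ K * g.norm)
    (hM : ∀ g : F N, (ψ⁻¹ g).norm ≤ M * g.norm) (i : ℕ) (l₂ : List (Letter N)) :
    ∀ l₁ : List (Letter N), FreeGroup.IsReduced (l₁ ++ l₂) → M * (i + K) + 1 ≤ l₁.length →
      (ψ (FreeGroup.mk (l₁ ++ l₂))).toWord.take i = (ψ (FreeGroup.mk l₁)).toWord.take i := by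
  induction l₂ with
  | nil => intro l₁ _ _; simp
  | cons x l ih =>
    intro l₁ hr hl
    have h1 : FreeGroup.IsReduced ((l₁ ++ [x]) ++ l) := by simpa using hr
    have h2 := ih (l₁ ++ [x]) h1 (by simp; omega)
    rw [show l₁ ++ x :: l = (l₁ ++ [x]) ++ l by simp, h2]
    refine take_eq_of_norm _ _ _ K ?_ ?_
    · rw [← FreeGroup.mul_mk, map_mul, inv_mul_cancel_left]
      exact (hK _).trans ((Nat.mul_le_mul_left K FreeGroup.norm_mk_le).trans (by simp))
    · have h3 := hM (ψ (FreeGroup.mk l₁))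
      rw [MulAut.inv_apply_self, norm_mk_of_isReduced (hr.infix ⟨[], x :: l, by simp⟩)] at h3
      by_contra hcon
      have := Nat.mul_le_mul_left M (not_le.1 hcon).le
      omega

/-- Continuity of the extension of an automorphism to the boundary. -/
theorem ConvergesTo.map {g : ℕ → F N} {X : Boundary N} (hg : ConvergesTo g X)
    (ψ : MulAut (F N)) : ConvergesTo (fun n => ψ (g n)) (boundaryMap ψ X) := by
  intro i
  obtain ⟨K, hK⟩ := exists_norm_bound ψ
  obtain ⟨M, hM⟩ := exists_norm_bound ψ⁻¹
  -- The image of the prefix of length `k` already has the right letter at `i`, and `k` is large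
  -- enough that no reduced continuation changes it.
  obtain ⟨k, hk1, hk2⟩ := ((boundaryMap_spec ψ X i).and
    (eventually_ge_atTop (M * (i + 1 + K) + 1))).exists
  filter_upwards [hg.take k] with n hn
  have h1 : (g n).toWord = (List.range k).map X.1 ++ (g n).toWord.drop k := by
    rw [← hn, List.take_append_drop]
  have h2 := take_map_append ψ hK hM (i + 1) ((g n).toWord.drop k) ((List.range k).map X.1)
    (h1 ▸ FreeGroup.isReduced_toWord) (by simpa using hk2)
  rw [← h1, FreeGroup.mk_toWord] at h2
  have h3 := congrArg (fun l => l[i]?) h2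
  simp only [List.getElem?_take_of_lt (Nat.lt_succ_self i)] at h3
  rw [h3]
  exact hk1

theorem convergesTo_pre (X : Boundary N) : ConvergesTo X.pre X := by
  intro i
  filter_upwards [eventually_gt_atTop i] with n hn
  rw [X.toWord_pre]
  simp [hn]

theorem boundaryMap_mul (ψ χ : MulAut (F N)) (X : Boundary N) :
    boundaryMap (ψ * χ) X = boundaryMap ψ (boundaryMap χ X) :=
  (boundaryMap_spec (ψ * χ) X).unique ((boundaryMap_spec χ X).map ψ)

theorem boundaryMap_one (X : Boundary N) : boundaryMap 1 X = X :=
  (boundaryMap_spec 1 X).unique (convergesTo_pre X)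

theorem doubleBoundaryMap_mul (ψ χ : MulAut (F N)) (Z : DoubleBoundary N) :
    doubleBoundaryMap (ψ * χ) Z = doubleBoundaryMap ψ (doubleBoundaryMap χ Z) :=
  Subtype.ext (Prod.ext (boundaryMap_mul ψ χ Z.1.1) (boundaryMap_mul ψ χ Z.1.2))

theorem doubleBoundaryMap_one (Z : DoubleBoundary N) : doubleBoundaryMap 1 Z = Z :=
  Subtype.ext (Prod.ext (boundaryMap_one Z.1.1) (boundaryMap_one Z.1.2))

theorem ConvergesTo.tendsto_norm {g : ℕ → F N} {X : Boundary N} (hg : ConvergesTo g X) :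
    Tendsto (fun n => (g n).norm) atTop atTop := by
  rw [tendsto_atTop]
  intro b
  filter_upwards [hg b] with n hn
  exact (List.getElem?_eq_some_iff.1 hn).1.le

theorem ConvergesTo.of_near {g g' : ℕ → F N} {X : Boundary N} (hg : ConvergesTo g X) (L : ℕ)
    (h : ∀ n, ((g n)⁻¹ * g' n).norm ≤ L) : ConvergesTo g' X := by
  intro i
  filter_upwards [hg i, hg.tendsto_norm.eventually_ge_atTop (i + 1 + L)] with n h1 h2
  have h3 := congrArg (fun l => l[i]?) (take_eq_of_norm (g n) (g' n) (i + 1) L (h n) h2)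
  simp only [List.getElem?_take_of_lt (Nat.lt_succ_self i)] at h3
  rw [h3, h1]

/-- Left multiplication on the boundary is induced by conjugation. -/
theorem ConvergesTo.mul_left {g : ℕ → F N} {X : Boundary N} (hg : ConvergesTo g X) (c : F N) :
    ConvergesTo (fun n => c * g n) (boundaryMap (MulAut.conj c) X) := by
  refine (hg.map (MulAut.conj c)).of_near c.norm fun n => ?_
  have : (MulAut.conj c (g n))⁻¹ * (c * g n) = c := by simp [MulAut.conj_apply]; group
  rw [this]

theorem mk_invLetter (x : Letter N) :
    (FreeGroup.mk [invLetter x] : F N) = (FreeGroup.mk [x])⁻¹ := by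
  simp [FreeGroup.inv_mk, FreeGroup.invRev, invLetter]

/-- Both sides are limits of `x * X.pre (n + 1)`. Starting at `n + 1` makes this a prefix of length
`n` of the left side when `x` cancels. -/
theorem letterMul_eq_boundaryMap (x : Letter N) (X : Boundary N) :
    letterMul x X = boundaryMap (MulAut.conj (FreeGroup.mk [x])) X := by
  refine ConvergesTo.unique (g := fun n => FreeGroup.mk [x] * X.pre (n + 1)) ?_
    (ConvergesTo.mul_left (fun i => (tendsto_add_atTop_nat 1).eventually (convergesTo_pre X i)) _)
  intro i
  by_cases h : X.1 0 = invLetter x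
  · have h1 : ∀ n, FreeGroup.mk [x] * X.pre (n + 1) = (letterMul x X).pre n := by
      intro n
      induction n with
      | zero =>
        have h2 : X.pre (0 + 1) = (FreeGroup.mk [x])⁻¹ := by
          rw [← mk_invLetter, ← h]
          simp [Boundary.pre]
        rw [h2, mul_inv_cancel]
        simp [Boundary.pre, ← FreeGroup.one_eq_mk]
      | succ n ih =>
        rw [Boundary.pre_succ, ← mul_assoc, ih, Boundary.pre_succ _ n]
        simp [letterMul, h]
    simp only [h1]
    exact convergesTo_pre _ i
  · have h1 : ∀ n, FreeGroup.mk [x] * X.pre n = (letterMul x X).pre (n + 1) := by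
      intro n
      induction n with
      | zero => simp [Boundary.pre, letterMul, h]
      | succ n ih =>
        rw [Boundary.pre_succ, ← mul_assoc, ih, Boundary.pre_succ _ (n + 1)]
        simp [letterMul, h]
    simp only [h1]
    exact (tendsto_add_atTop_nat 2).eventually (convergesTo_pre _ i)

theorem boundaryMap_conj_inv_pre (X : Boundary N) (m i : ℕ) :
    (boundaryMap (MulAut.conj (X.pre m)⁻¹) X).1 i = X.1 (m + i) := by
  induction m generalizing i with
  | zero => simp [Boundary.pre, ← FreeGroup.one_eq_mk, boundaryMap_one]
  | succ m ih =>
    rw [X.pre_succ, mul_inv_rev, map_mul, boundaryMap_mul, ← mk_invLetter,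
      ← letterMul_eq_boundaryMap]
    have h0 := ih 0
    rw [add_zero] at h0
    simp only [letterMul, invLetter_invLetter, h0, dif_pos]
    rw [ih (i + 1), show m + (i + 1) = m + 1 + i by omega]

theorem letterMul₂_eq (x : Letter N) (Z : DoubleBoundary N) :
    letterMul₂ x Z = doubleBoundaryMap (MulAut.conj (FreeGroup.mk [x])) Z :=
  Subtype.ext (Prod.ext (letterMul_eq_boundaryMap x Z.1.1) (letterMul_eq_boundaryMap x Z.1.2))

theorem shift_iterate (Z : DoubleBoundary N) (m : ℕ) :
    shift^[m] Z = doubleBoundaryMap (MulAut.conj (Z.1.2.pre m)⁻¹) Z := by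
  induction m with
  | zero => simp [Boundary.pre, ← FreeGroup.one_eq_mk, doubleBoundaryMap_one]
  | succ m ih =>
    have h : (doubleBoundaryMap (MulAut.conj (Z.1.2.pre m)⁻¹) Z).1.2.1 0 = Z.1.2.1 m :=
      boundaryMap_conj_inv_pre Z.1.2 m 0
    rw [Function.iterate_succ_apply', ih, shift, h, letterMul₂_eq, ← doubleBoundaryMap_mul,
      ← map_mul, mk_invLetter, Boundary.pre_succ, mul_inv_rev]

theorem shiftInv_iterate (Z : DoubleBoundary N) (m : ℕ) :
    shiftInv^[m] Z = doubleBoundaryMap (MulAut.conj (Z.1.1.pre m)⁻¹) Z := by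
  induction m with
  | zero => simp [Boundary.pre, ← FreeGroup.one_eq_mk, doubleBoundaryMap_one]
  | succ m ih =>
    have h : (doubleBoundaryMap (MulAut.conj (Z.1.1.pre m)⁻¹) Z).1.1.1 0 = Z.1.1.1 m :=
      boundaryMap_conj_inv_pre Z.1.1 m 0
    rw [Function.iterate_succ_apply', ih, shiftInv, h, letterMul₂_eq, ← doubleBoundaryMap_mul,
      ← map_mul, mk_invLetter, Boundary.pre_succ, mul_inv_rev]

theorem mul_conj (φ : MulAut (F N)) (g : F N) : φ * MulAut.conj g = MulAut.conj (φ g) * φ := by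
  ext x
  simp [MulAut.conj_apply]

end BoundaryAction

/-! ### Words of one sign and growth under a positive primitive automorphism. -/

section Signed

variable {N : ℕ}

/-- All letters of the word have the same given sign. -/
def Signed (b : Bool) (g : F N) : Prop := ∀ x ∈ g.toWord, x.2 = b

theorem isReduced_of_sign {b : Bool} {l : List (Letter N)} (h : ∀ x ∈ l, x.2 = b) :
    FreeGroup.IsReduced l := by
  rw [FreeGroup.IsReduced, List.isChain_iff_getElem]
  intro i hi _
  rw [h _ (List.getElem_mem _), h _ (List.getElem_mem _)]

theorem toWord_mk_of_sign {b : Bool} {l : List (Letter N)} (h : ∀ x ∈ l, x.2 = b) :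
    (FreeGroup.mk l : F N).toWord = l := by
  rw [FreeGroup.toWord_mk, (isReduced_of_sign h).reduce_eq]

theorem signed_mk {b : Bool} {l : List (Letter N)} (h : ∀ x ∈ l, x.2 = b) :
    Signed b (FreeGroup.mk l : F N) := by
  rwa [Signed, toWord_mk_of_sign h]

theorem signed_one (b : Bool) : Signed b (1 : F N) := by simp [Signed]

theorem Signed.toWord_mul {b : Bool} {g h : F N} (hg : Signed b g) (hh : Signed b h) :
    (g * h).toWord = g.toWord ++ h.toWord := by
  rw [FreeGroup.toWord_mul]
  apply FreeGroup.IsReduced.reduce_eq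
  apply isReduced_of_sign (b := b)
  intro x hx
  exact (List.mem_append.1 hx).elim (hg x) (hh x)

theorem Signed.mul {b : Bool} {g h : F N} (hg : Signed b g) (hh : Signed b h) :
    Signed b (g * h) := by
  intro x hx
  rw [hg.toWord_mul hh] at hx
  exact (List.mem_append.1 hx).elim (hg x) (hh x)

theorem Signed.norm_mul {b : Bool} {g h : F N} (hg : Signed b g) (hh : Signed b h) :
    (g * h).norm = g.norm + h.norm := by
  simp [FreeGroup.norm, hg.toWord_mul hh]

theorem Signed.inv {b : Bool} {g : F N} (hg : Signed b g) : Signed (!b) g⁻¹ := by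
  intro x hx
  simp only [FreeGroup.toWord_inv, FreeGroup.invRev, List.mem_reverse, List.mem_map] at hx
  obtain ⟨y, hy, rfl⟩ := hx
  simp [hg y hy]

theorem Signed.prod {b : Bool} {l : List (F N)} (h : ∀ g ∈ l, Signed b g) : Signed b l.prod := by
  induction l with
  | nil => exact signed_one b
  | cons g l ih =>
    rw [List.prod_cons]
    exact (h g (by simp)).mul (ih fun g hg => h g (by simp [hg]))

theorem FactorsAs.signed {v p s : F N} {a : Fin N} (h : FactorsAs v p a s) (hv : Signed true v) :
    Signed true p ∧ Signed true s := by
  rw [FactorsAs] at h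
  constructor <;> intro x hx <;> apply hv <;> rw [h] <;> simp [hx]

theorem FactorsAs.eq_mul {v p s : F N} {a : Fin N} (h : FactorsAs v p a s) :
    v = p * FreeGroup.of a * s := by
  rw [FactorsAs] at h
  have h2 := congrArg FreeGroup.mk h
  rw [FreeGroup.mk_toWord] at h2
  rw [h2, ← FreeGroup.mk_toWord (x := p), ← FreeGroup.mk_toWord (x := s), FreeGroup.of,
    FreeGroup.mul_mk, FreeGroup.mul_mk]
  simp

theorem signed_of (a : Fin N) : Signed true (FreeGroup.of a) := by simp [Signed]

theorem signed_letter (x : Letter N) : Signed x.2 (FreeGroup.mk [x] : F N) :=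
  signed_mk (by simp)

theorem IsPositive.signed_letter {φ : MulAut (F N)} (hφ : IsPositive φ) (x : Letter N) :
    Signed x.2 (φ (FreeGroup.mk [x])) ∧ 1 ≤ (φ (FreeGroup.mk [x])).norm := by
  have h0 : ∀ a, 1 ≤ (φ (FreeGroup.of a)).norm := fun a => by
    rw [Nat.one_le_iff_ne_zero, Ne, FreeGroup.norm_eq_zero]
    exact (hφ a).1
  obtain ⟨a, b⟩ := x
  cases b
  · have h1 : (FreeGroup.mk [(a, false)] : F N) = (FreeGroup.of a)⁻¹ := by
      rw [FreeGroup.of, ← mk_invLetter]; rfl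
    rw [h1, map_inv, FreeGroup.norm_inv_eq]
    exact ⟨Signed.inv (hφ a).2, h0 a⟩
  · exact ⟨(hφ a).2, h0 a⟩

theorem mk_cons (x : Letter N) (l : List (Letter N)) :
    (FreeGroup.mk (x :: l) : F N) = FreeGroup.mk [x] * FreeGroup.mk l := by
  simp [FreeGroup.mul_mk]

/-- If the images of letters have length at least `c`, then lengths of signed words are
multiplied by at least `c`. -/
theorem IsPositive.signed_map_norm {φ : MulAut (F N)} (hφ : IsPositive φ) {c : ℕ}
    (hc : ∀ a, c ≤ (φ (FreeGroup.of a)).norm) {b : Bool} {g : F N} (hg : Signed b g) :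
    Signed b (φ g) ∧ c * g.norm ≤ (φ g).norm := by
  have key : ∀ l : List (Letter N), (∀ x ∈ l, x.2 = b) →
      Signed b (φ (FreeGroup.mk l)) ∧ c * l.length ≤ (φ (FreeGroup.mk l)).norm := by
    intro l hl
    induction l with
    | nil => simp [← FreeGroup.one_eq_mk, signed_one]
    | cons x l ih =>
      obtain ⟨h1, h2⟩ := ih fun y hy => hl y (by simp [hy])
      have h3 := (hφ.signed_letter x).1
      rw [hl x (by simp)] at h3
      have h4 : c ≤ (φ (FreeGroup.mk [x])).norm := by
        obtain ⟨a, e⟩ := x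
        cases e
        · have h1 : (FreeGroup.mk [(a, false)] : F N) = (FreeGroup.of a)⁻¹ := by
            rw [FreeGroup.of, ← mk_invLetter]; rfl
          rw [h1, map_inv, FreeGroup.norm_inv_eq]
          exact hc a
        · exact hc a
      rw [mk_cons, map_mul, h3.norm_mul h1, List.length_cons, mul_add]
      exact ⟨h3.mul h1, by omega⟩
  have := key g.toWord hg
  rwa [FreeGroup.mk_toWord] at this

theorem IsPositive.signed_map {φ : MulAut (F N)} (hφ : IsPositive φ) {b : Bool} {g : F N}
    (hg : Signed b g) : Signed b (φ g) :=
  (hφ.signed_map_norm (c := 0) (by simp) hg).1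

theorem IsPositive.norm_le {φ : MulAut (F N)} (hφ : IsPositive φ) {b : Bool} {g : F N}
    (hg : Signed b g) : g.norm ≤ (φ g).norm := by
  simpa using (hφ.signed_map_norm (c := 1) (fun a => (hφ.signed_letter (a, true)).2) hg).2

theorem IsPositive.pow {φ : MulAut (F N)} (hφ : IsPositive φ) (m : ℕ) : IsPositive (φ ^ m) := by
  induction m with
  | zero => intro a; exact ⟨FreeGroup.of_ne_one a, signed_of a⟩
  | succ m ih =>
    intro a
    refine ⟨fun h => FreeGroup.of_ne_one a ((φ ^ (m + 1)).injective (h.trans (map_one _).symm)), ?_⟩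
    rw [pow_succ', MulAut.mul_apply]
    exact hφ.signed_map (ih a).2

/-- With at least two letters in the basis, primitivity gives a power `φ^k` sending each letter to a
word of length at least 2. That power doubles signed words, and the other powers do not shorten
them. -/
theorem IsPrimitive.exists_growth (hN : 2 ≤ N) {φ : MulAut (F N)} (hφ : IsPositive φ)
    (hprim : IsPrimitive φ) (R : ℕ) : ∃ m₀, ∀ m, m₀ ≤ m → ∀ (b : Bool) (g : F N),
      Signed b g → g ≠ 1 → R ≤ ((φ ^ m) g).norm := by
  obtain ⟨k, -, hk⟩ := hprim
  have h2 : ∀ a, 2 ≤ ((φ ^ k) (FreeGroup.of a)).norm := by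
    intro a
    have h0 := hk a ⟨0, by omega⟩
    have h1 := hk a ⟨1, by omega⟩
    by_contra hcon
    rw [FreeGroup.norm] at hcon
    obtain ⟨i, hi, hi'⟩ := List.getElem_of_mem h0
    obtain ⟨j, hj, hj'⟩ := List.getElem_of_mem h1
    have : i = j := by omega
    subst this
    rw [hi'] at hj'
    simp at hj'
  have h3 : ∀ (t : ℕ) (b : Bool) (g : F N), Signed b g → g ≠ 1 →
      t ≤ ((φ ^ (k * t)) g).norm := by
    intro t b g hg hg1
    induction t with
    | zero => simp
    | succ t ih =>
      have h4 := ((hφ.pow (k * t)).signed_map hg)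
      have h5 := ((hφ.pow k).signed_map_norm h2 h4).2
      rw [mul_add, mul_one, add_comm (k * t) k, pow_add, MulAut.mul_apply]
      have h6 := (hφ.pow (k * t)).norm_le hg
      have h7 : g.norm ≠ 0 := by rwa [Ne, FreeGroup.norm_eq_zero]
      omega
  refine ⟨k * R, fun m hm b g hg hg1 => (h3 R b g hg hg1).trans ?_⟩
  obtain ⟨r, rfl⟩ := Nat.exists_eq_add_of_le hm
  rw [add_comm, pow_add, MulAut.mul_apply]
  exact (hφ.pow r).norm_le ((hφ.pow _).signed_map hg)

end Signed

/-! ### Boundary points of one sign and periodicity of backward orbits. -/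

section SignedBoundary

variable {N : ℕ}

/-- All letters of the boundary point have the same given sign. -/
def Boundary.Signed (b : Bool) (T : Boundary N) : Prop := ∀ i, (T.1 i).2 = b

/-- The first coordinate is negative and the second one is positive. -/
def IsLine (Z : DoubleBoundary N) : Prop := Z.1.1.Signed false ∧ Z.1.2.Signed true

theorem ConvergesTo.signed {b : Bool} {g : ℕ → F N} {T : Boundary N} (h : ConvergesTo g T)
    (hg : ∀ n, PrefixSuffix.Signed b (g n)) : T.Signed b := by
  intro i
  obtain ⟨n, hn⟩ := (h i).exists
  exact hg n _ (List.mem_of_getElem? hn)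

theorem letterMul_signed {b : Bool} {x : Letter N} {T : Boundary N} (hT : T.Signed b)
    (hx : x.2 = b ∨ T.1 0 = invLetter x) : (letterMul x T).Signed b := by
  intro i
  rw [letterMul]
  split_ifs with h
  · exact hT (i + 1)
  · cases i with
    | zero => exact hx.resolve_right h
    | succ i => exact hT i

theorem IsLine.shift {Z : DoubleBoundary N} (hZ : IsLine Z) : IsLine (shift Z) :=
  ⟨letterMul_signed hZ.1 (Or.inl (by simp [invLetter, hZ.2 0])),
    letterMul_signed hZ.2 (Or.inr (invLetter_invLetter _).symm)⟩

theorem IsLine.shiftInv {Z : DoubleBoundary N} (hZ : IsLine Z) : IsLine (shiftInv Z) :=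
  ⟨letterMul_signed hZ.1 (Or.inr (invLetter_invLetter _).symm),
    letterMul_signed hZ.2 (Or.inl (by simp [invLetter, hZ.1 0]))⟩

theorem IsLine.shiftPow {Z : DoubleBoundary N} (hZ : IsLine Z) (j : ℤ) :
    IsLine (shiftPow j Z) := by
  rw [PrefixSuffix.shiftPow]
  split_ifs
  · exact Function.Iterate.rec IsLine hZ (fun _ h => h.shift) _
  · exact Function.Iterate.rec IsLine hZ (fun _ h => h.shiftInv) _

theorem IsGenerator.isLine {φ : MulAut (F N)} (hφ : IsPositive φ) {Z : DoubleBoundary N}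
    (hZ : IsGenerator φ Z) : IsLine Z := by
  obtain ⟨a, k, p, s, -, -, hf, hX, hY⟩ := hZ
  obtain ⟨hp, hs⟩ := hf.signed (hφ.pow k a).2
  constructor
  · refine hX.signed fun n => Signed.prod ?_
    simp only [List.mem_map, forall_exists_index, and_imp]
    rintro _ i - rfl
    exact (hφ.pow _).signed_map hp.inv
  · refine hY.signed fun n => (signed_of a).mul (Signed.prod ?_)
    simp only [List.mem_map, forall_exists_index, and_imp]
    rintro _ i - rfl
    exact (hφ.pow _).signed_map hs

theorem isClosed_isLine : IsClosed {Z : DoubleBoundary N | IsLine Z} := by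
  simp only [IsLine, Boundary.Signed, Set.ofPred_and, Set.ofPred_forall]
  have hc (i : ℕ) : Continuous fun T : Boundary N => (T.1 i).2 :=
    continuous_snd.comp ((continuous_apply i).comp continuous_subtype_val)
  exact (isClosed_iInter fun i => isClosed_eq
      ((hc i).comp (continuous_fst.comp continuous_subtype_val)) continuous_const).inter
    (isClosed_iInter fun i => isClosed_eq
      ((hc i).comp (continuous_snd.comp continuous_subtype_val)) continuous_const)

/-- The sign condition holds for generators, is preserved by both shifts and is closed. -/
theorem isLine_of_mem {φ : MulAut (F N)} (hφ : IsPositive φ) {Z : DoubleBoundary N}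
    (hZ : Z ∈ attractingSubshift φ) : IsLine Z := by
  simp only [attractingSubshift, Set.mem_iUnion] at hZ
  obtain ⟨G, hG, hZ⟩ := hZ
  refine closure_minimal ?_ isClosed_isLine hZ
  rintro _ ⟨j, rfl⟩
  exact (IsGenerator.isLine hφ hG).shiftPow j

theorem Boundary.Signed.pre {b : Bool} {T : Boundary N} (hT : T.Signed b) (n : ℕ) :
    PrefixSuffix.Signed b (T.pre n) := by
  intro x hx
  rw [T.toWord_pre, List.mem_map] at hx
  obtain ⟨i, -, rfl⟩ := hx
  exact hT i

theorem Boundary.Signed.exists_pre_eq_mul {b : Bool} {T : Boundary N} (hT : T.Signed b) {m n : ℕ}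
    (h : m ≤ n) : ∃ r, PrefixSuffix.Signed b r ∧ T.pre n = T.pre m * r := by
  induction n, h using Nat.le_induction with
  | base => exact ⟨1, signed_one b, (mul_one _).symm⟩
  | succ n _ ih =>
    obtain ⟨r, hr, h⟩ := ih
    refine ⟨r * FreeGroup.mk [T.1 n], hr.mul ?_, ?_⟩
    · have := signed_letter (T.1 n)
      rwa [hT n] at this
    · rw [T.pre_succ, h, mul_assoc]

/-- The reduced word `g` is a prefix of the boundary point `T`. -/
def Boundary.StartsWith (T : Boundary N) (g : F N) : Prop := T.pre g.norm = g

theorem Boundary.startsWith_iff {T : Boundary N} {g : F N} :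
    T.StartsWith g ↔ ∀ i < g.norm, g.toWord[i]? = some (T.1 i) := by
  constructor
  · intro h i hi
    rw [← h, T.toWord_pre]
    simp [hi]
  · intro h
    apply FreeGroup.toWord_injective
    rw [T.toWord_pre]
    apply List.ext_getElem?
    intro i
    by_cases hi : i < g.norm
    · rw [h i hi]
      simp [hi]
    · rw [List.getElem?_eq_none (by simpa using hi),
        List.getElem?_eq_none (by simpa [FreeGroup.norm] using hi)]

theorem Boundary.startsWith_letter (T : Boundary N) : T.StartsWith (FreeGroup.mk [T.1 0]) := by
  have h : (FreeGroup.mk [T.1 0] : F N).norm = 1 :=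
    norm_mk_of_isReduced FreeGroup.IsReduced.singleton
  rw [StartsWith, h]
  simp [Boundary.pre]

theorem Boundary.StartsWith.of_mul {T : Boundary N} {b : Bool} {g h : F N}
    (hT : T.StartsWith (g * h)) (hg : PrefixSuffix.Signed b g) (hh : PrefixSuffix.Signed b h) :
    T.StartsWith g := by
  rw [startsWith_iff] at hT ⊢
  intro i hi
  have := hT i (by rw [hg.norm_mul hh]; omega)
  rwa [hg.toWord_mul hh, List.getElem?_append_left hi] at this

theorem convergesTo_map_mul (φ : MulAut (F N)) (q : F N) (T : Boundary N) :
    ConvergesTo (fun n => q * φ (T.pre n)) (boundaryMap (MulAut.conj q * φ) T) := by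
  rw [boundaryMap_mul]
  exact (boundaryMap_spec φ T).mul_left q

/-- All factors have the same sign, so nothing cancels. -/
theorem Boundary.StartsWith.map {φ : MulAut (F N)} (hφ : IsPositive φ) {b : Bool} {q g : F N}
    {T : Boundary N} (hq : PrefixSuffix.Signed b q) (hg : PrefixSuffix.Signed b g)
    (hT : T.Signed b) (h : T.StartsWith g) :
    (boundaryMap (MulAut.conj q * φ) T).StartsWith (q * φ g) := by
  rw [startsWith_iff]
  intro i hi
  obtain ⟨n, hn, hn'⟩ := ((convergesTo_map_mul φ q T i).and (eventually_ge_atTop g.norm)).exists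
  obtain ⟨r, hr, h1⟩ := hT.exists_pre_eq_mul hn'
  rw [h] at h1
  beta_reduce at hn
  rw [h1, map_mul, ← mul_assoc,
    (hq.mul (hφ.signed_map hg)).toWord_mul (hφ.signed_map hr), List.getElem?_append_left hi] at hn
  exact hn

/-- Backward orbits of a self-map of a finite set are periodic. -/
theorem exists_periodic_of_backward_orbit {α : Type*} [Finite α] (f : α → α) (x : ℕ → α)
    (hx : ∀ i, x i = f (x (i + 1))) : ∃ h, 1 ≤ h ∧ Function.Periodic x h := by
  have hit : ∀ m i, x i = f^[m] (x (i + m)) := by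
    intro m
    induction m with
    | zero => intro i; rfl
    | succ m ih =>
      intro i
      rw [Function.iterate_succ_apply, ← add_assoc, ← hx, ← ih]
  -- A value `c` taken infinitely often is a periodic point of `f`. Every `x i` is a forward image
  -- of `c`, so it inherits the period.
  obtain ⟨c, hc⟩ := Finite.exists_infinite_fiber x
  rw [Set.infinite_coe_iff] at hc
  obtain ⟨i₀, h0⟩ := hc.nonempty
  obtain ⟨i₁, h1, hlt⟩ := hc.exists_gt i₀
  obtain ⟨h, rfl⟩ := Nat.exists_eq_add_of_lt hlt
  refine ⟨h + 1, by omega, fun i => ?_⟩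
  have hc' : f^[h + 1] c = c := by
    have := hit (h + 1) i₀
    rw [h0, ← add_assoc, h1] at this
    exact this.symm
  obtain ⟨m, hm, hlt⟩ := hc.exists_gt (i + (h + 1))
  obtain ⟨r, rfl⟩ := Nat.exists_eq_add_of_lt hlt
  have e1 := hit (r + 1 + (h + 1)) i
  have e2 := hit (r + 1) (i + (h + 1))
  rw [show i + (r + 1 + (h + 1)) = i + (h + 1) + r + 1 by omega, hm, Function.iterate_add_apply,
    hc'] at e1
  rw [show i + (h + 1) + (r + 1) = i + (h + 1) + r + 1 by omega, hm] at e2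
  rw [e1, e2]

/-- A backward orbit of signed boundary points under `T ↦ q * ∂φ (T)` is periodic. -/
theorem exists_periodic_of_signed (hN : 2 ≤ N) {φ : MulAut (F N)} (hφ : IsPositive φ)
    (hprim : IsPrimitive φ) {b : Bool} {q : F N} (hq : Signed b q) (T : ℕ → Boundary N)
    (hT : ∀ i, (T i).Signed b)
    (hrec : ∀ i, T i = boundaryMap (MulAut.conj q * φ) (T (i + 1))) :
    ∃ h, 1 ≤ h ∧ Function.Periodic T h := by
  have hsx : ∀ i, Signed b (FreeGroup.mk [(T i).1 0] : F N) := fun i => by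
    have := signed_letter ((T i).1 0)
    rwa [hT i 0] at this
  -- The first letter of `T i` is that of `q φ(x)`, with `x` the first letter of `T (i + 1)`. The
  -- default of `getD` does not matter, since `φ(x)` is not empty.
  obtain ⟨h, h1, hper⟩ := exists_periodic_of_backward_orbit
    (fun x => ((q * φ (FreeGroup.mk [x])).toWord[0]?).getD x) (fun i => (T i).1 0) (by
      intro i
      have h1 := (T (i + 1)).startsWith_letter.map hφ hq (hsx _) (hT _)
      rw [← hrec, Boundary.startsWith_iff] at h1
      have h2 : 0 < (q * φ (FreeGroup.mk [(T (i + 1)).1 0])).norm := by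
        rw [hq.norm_mul (hφ.signed_map (hsx _))]
        have := (hφ.signed_letter ((T (i + 1)).1 0)).2
        omega
      simp only [h1 0 h2, Option.getD_some])
  refine ⟨h, h1, fun i => ?_⟩
  -- `v x m` is the prefix of `T i` forced by the first letter `x` of `T (i + m)`. It ends with
  -- `φ^m(x)`, so its length tends to infinity with `m`.
  let v : Letter N → ℕ → F N := fun x m => (fun g => q * φ g)^[m] (FreeGroup.mk [x])
  have hv : ∀ m i, Signed b (v ((T i).1 0) m) ∧
      ((φ ^ m) (FreeGroup.mk [(T i).1 0])).norm ≤ (v ((T i).1 0) m).norm := by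
    intro m i
    suffices H : ∃ c, Signed b c ∧ Signed b (v ((T i).1 0) m) ∧
        v ((T i).1 0) m = c * (φ ^ m) (FreeGroup.mk [(T i).1 0]) by
      obtain ⟨c, hc, h2, h3⟩ := H
      refine ⟨h2, ?_⟩
      rw [h3, hc.norm_mul ((hφ.pow m).signed_map (hsx i))]
      omega
    induction m with
    | zero => exact ⟨1, signed_one b, hsx i, (one_mul _).symm⟩
    | succ m ih =>
      obtain ⟨c, hc, h2, h3⟩ := ih
      have h4 : v ((T i).1 0) (m + 1) = q * φ (v ((T i).1 0) m) :=
        Function.iterate_succ_apply' _ _ _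
      rw [h4]
      exact ⟨q * φ c, hq.mul (hφ.signed_map hc), hq.mul (hφ.signed_map h2),
        by rw [h3, map_mul, pow_succ', MulAut.mul_apply, mul_assoc]⟩
  have hst : ∀ m i, (T i).StartsWith (v ((T (i + m)).1 0) m) := by
    intro m
    induction m with
    | zero => exact fun i => (T i).startsWith_letter
    | succ m ih =>
      intro i
      have h2 := (ih (i + 1)).map hφ hq (hv _ _).1 (hT _)
      rw [← hrec, show i + 1 + m = i + (m + 1) by omega] at h2
      have h4 : v ((T (i + (m + 1))).1 0) (m + 1) = q * φ (v ((T (i + (m + 1))).1 0) m) :=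
        Function.iterate_succ_apply' _ _ _
      rwa [h4]
  apply Subtype.ext
  funext c
  obtain ⟨m, hm⟩ := IsPrimitive.exists_growth hN hφ hprim (c + 1)
  have hne : (FreeGroup.mk [(T (i + m)).1 0] : F N) ≠ 1 := by
    rw [Ne, ← FreeGroup.norm_eq_zero, norm_mk_of_isReduced FreeGroup.IsReduced.singleton]
    simp
  have h2 := hm m le_rfl b _ (hsx (i + m)) hne
  have h3 := (hv m (i + m)).2
  have h4 := Boundary.startsWith_iff.1 (hst m i) c (by omega)
  have h5 := hst m (i + h)
  have h6 : (T (i + h + m)).1 0 = (T (i + m)).1 0 := by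
    have := hper (i + m)
    rwa [show i + m + h = i + h + m by omega] at this
  rw [h6] at h5
  have h7 := Boundary.startsWith_iff.1 h5 c (by omega)
  rw [h4] at h7
  exact (Option.some.inj h7).symm

/-- Unless it is cancelled entirely, a left factor leaves its first letter. -/
theorem conj_eq_inv_pre_or_head (T : Boundary N) (l : List (Letter N)) :
    FreeGroup.IsReduced l → (FreeGroup.mk l : F N) = (T.pre l.length)⁻¹ ∨
      l.head? = some ((boundaryMap (MulAut.conj (FreeGroup.mk l)) T).1 0) := by
  induction l with
  | nil => intro _; left; simp [Boundary.pre, ← FreeGroup.one_eq_mk]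
  | cons x l ih =>
    intro hr
    have hl : FreeGroup.IsReduced l := hr.infix ⟨[x], [], by simp⟩
    rw [mk_cons, map_mul, boundaryMap_mul, ← letterMul_eq_boundaryMap]
    by_cases hc : (boundaryMap (MulAut.conj (FreeGroup.mk l)) T).1 0 = invLetter x
    · left
      rcases ih hl with h | h
      · rw [h, boundaryMap_conj_inv_pre, add_zero] at hc
        rw [h, List.length_cons, T.pre_succ, hc, mul_inv_rev, mk_invLetter, inv_inv]
      · exfalso
        obtain ⟨l', rfl⟩ : ∃ l', l = invLetter x :: l' := by
          cases l with
          | nil => simp at h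
          | cons y l' => exact ⟨l', by simp [← hc] at h ⊢; exact h⟩
        rw [FreeGroup.isReduced_cons_cons] at hr
        simpa [invLetter] using hr.1
    · right
      simp [letterMul, hc]

/-- If neither half of `Z` absorbs `k` entirely, the first letter of `k` starts both halves of `k
Z`, which have opposite signs. Otherwise `k⁻¹` is a prefix of one half, hence signed. -/
theorem Signed.of_isLine {k : F N} {Z : DoubleBoundary N} (hZ : IsLine Z)
    (hkZ : IsLine (doubleBoundaryMap (MulAut.conj k) Z)) : ∃ b, Signed b k := by
  have h1 := conj_eq_inv_pre_or_head Z.1.1 k.toWord FreeGroup.isReduced_toWord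
  have h2 := conj_eq_inv_pre_or_head Z.1.2 k.toWord FreeGroup.isReduced_toWord
  rw [FreeGroup.mk_toWord] at h1 h2
  rcases h1 with h1 | h1
  · exact ⟨_, h1 ▸ (hZ.1.pre _).inv⟩
  rcases h2 with h2 | h2
  · exact ⟨_, h2 ▸ (hZ.2.pre _).inv⟩
  rw [h1] at h2
  have h3 := hkZ.1 0
  have h4 := hkZ.2 0
  have h5 := congrArg Prod.snd (Option.some.inj h2)
  simp only [doubleBoundaryMap] at h3 h4
  rw [h3, h4] at h5
  exact absurd h5 (by simp)

end SignedBoundary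

/-! ### Products along a development and iterates of the gamma maps. -/

section DevelopmentWord

variable {N : ℕ}

/-- The word `σ_0 φ(σ_1) ⋯ φ^{n-1}(σ_{n-1})`. -/
def devWord (φ : MulAut (F N)) (σ : ℕ → F N) (n : ℕ) : F N :=
  ((List.range n).map fun i => (φ ^ i) (σ i)).prod

theorem devWord_zero (φ : MulAut (F N)) (σ : ℕ → F N) : devWord φ σ 0 = 1 := rfl

theorem devWord_succ (φ : MulAut (F N)) (σ : ℕ → F N) (n : ℕ) :
    devWord φ σ (n + 1) = devWord φ σ n * (φ ^ n) (σ n) := by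
  simp [devWord, List.range_succ]

theorem devWord_const_succ (φ : MulAut (F N)) (q : F N) (n : ℕ) :
    devWord φ (fun _ => q) (n + 1) = q * φ (devWord φ (fun _ => q) n) := by
  induction n with
  | zero => simp [devWord]
  | succ n ih => rw [devWord_succ, ih, pow_succ', MulAut.mul_apply, mul_assoc, ← map_mul, ← ih,
      devWord_succ]

theorem devWord_signed {φ : MulAut (F N)} (hφ : IsPositive φ) {b : Bool} {σ : ℕ → F N}
    (hσ : ∀ i, Signed b (σ i)) (n : ℕ) : Signed b (devWord φ σ n) := by
  refine Signed.prod ?_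
  simp only [List.mem_map, forall_exists_index, and_imp]
  rintro _ i - rfl
  exact (hφ.pow i).signed_map (hσ i)

theorem IsAdmissible.signed {φ : MulAut (F N)} (hφ : IsPositive φ) {d : ℕ → Label N}
    (hd : IsAdmissible φ d) (i : ℕ) : Signed true (d i).1 ∧ Signed true (d i).2.2 :=
  (hd i).signed (hφ _).2

/-- The prefixes accumulate in the reverse order `φ^{n-1}(p_{n-1}) ⋯ p_0`, which is the inverse of
the `devWord` of the `p_i⁻¹`. -/
theorem IsAdmissible.pow_apply {φ : MulAut (F N)} {d : ℕ → Label N} (hd : IsAdmissible φ d)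
    (n : ℕ) : (φ ^ n) (FreeGroup.of (d n).2.1) = (devWord φ (fun i => (d i).1⁻¹) n)⁻¹ *
      FreeGroup.of (d 0).2.1 * devWord φ (fun i => (d i).2.2) n := by
  induction n with
  | zero => simp [devWord]
  | succ n ih =>
    rw [pow_succ, MulAut.mul_apply, (hd n).eq_mul, map_mul, map_mul, ih, devWord_succ,
      devWord_succ, map_inv]
    group

theorem gammaPlus_iterate_mk {φ : MulAut (F N)} (hφ : IsPositive φ) {b : Bool} {q : F N}
    (hq : Signed b q) (n : ℕ) (l : List (Letter N)) : (∀ x ∈ l, x.2 = b) → ∀ r, Signed b r →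
      devWord φ (fun _ => q) n = FreeGroup.mk l * r →
      (gammaPlus φ)^[l.length] q = (FreeGroup.mk l)⁻¹ * q * φ (FreeGroup.mk l) := by
  induction l using List.reverseRecOn with
  | nil => intro _ r _ _; simp [← FreeGroup.one_eq_mk]
  | append_singleton l x ih =>
    intro hl r hr h
    have hl' : ∀ y ∈ l, y.2 = b := fun y hy => hl y (by simp [hy])
    have hx : Signed b (FreeGroup.mk [x] : F N) := by
      have := signed_letter x
      rwa [hl x (by simp)] at this
    have hml : Signed b (FreeGroup.mk l : F N) := signed_mk hl'
    have hA : Signed b (q * φ (FreeGroup.mk l)) := hq.mul (hφ.signed_map hml)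
    have hmlx : Signed b (FreeGroup.mk (l ++ [x]) : F N) := signed_mk hl
    have hword : (FreeGroup.mk (l ++ [x]) : F N).toWord = l ++ [x] := toWord_mk_of_sign hl
    -- For `q = 1` the product would be empty and could not have the nonempty prefix `l ++ [x]`.
    have hq1 : q ≠ 1 := by
      rintro rfl
      have h1 : (FreeGroup.mk (l ++ [x]) * r).norm = 0 := by
        rw [← h]
        simp [devWord]
      rw [hmlx.norm_mul hr, FreeGroup.norm, hword] at h1
      simp at h1
    have hlen : (l ++ [x]).length ≤ (q * φ (FreeGroup.mk l)).toWord.length := by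
      have h1 := hq.norm_mul (hφ.signed_map hml)
      have h2 := hφ.norm_le hml
      have h3 : q.norm ≠ 0 := by rwa [Ne, FreeGroup.norm_eq_zero]
      rw [norm_mk_of_isReduced (isReduced_of_sign hl')] at h2
      simp only [FreeGroup.norm] at *
      simp only [List.length_append, List.length_singleton]
      omega
    -- Both sides spell `q φ(q) ⋯ φ^n(q)`, with `q` split off on the left or `φ^n(q)` on the right.
    -- By length, `l x` is then a prefix of `q φ(l)`, so `l⁻¹ q φ(l)` starts with `x`, the letter
    -- that `gammaPlus` moves next.
    have hsplit : (q * φ (FreeGroup.mk l)).toWord ++ (φ (FreeGroup.mk [x] * r)).toWord =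
        (l ++ [x]) ++ (r * (φ ^ n) q).toWord := by
      have h1 := devWord_const_succ φ q n
      rw [devWord_succ, h, mul_assoc] at h1
      nth_rw 2 [← FreeGroup.mul_mk] at h1
      rw [mul_assoc (FreeGroup.mk l), map_mul φ (FreeGroup.mk l), ← mul_assoc q] at h1
      have h2 := congrArg FreeGroup.toWord h1
      rw [hA.toWord_mul (hφ.signed_map (hx.mul hr)),
        hmlx.toWord_mul (hr.mul ((hφ.pow n).signed_map hq)), hword] at h2
      exact h2.symm
    obtain ⟨t, ht⟩ : (l ++ [x]) <+: (q * φ (FreeGroup.mk l)).toWord :=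
      List.prefix_of_prefix_length_le (List.prefix_append _ _)
        (hsplit ▸ List.prefix_append _ _) hlen
    have ht' : q * φ (FreeGroup.mk l) = FreeGroup.mk l * FreeGroup.mk (x :: t) := by
      rw [← FreeGroup.mk_toWord (x := q * φ (FreeGroup.mk l)), ← ht, FreeGroup.mul_mk]
      simp
    have hxt : (FreeGroup.mk (x :: t) : F N).toWord = x :: t := by
      apply toWord_mk_of_sign (b := b)
      intro y hy
      apply hA
      rw [← ht]
      simp only [List.mem_append, List.mem_cons, List.not_mem_nil, or_false] at hy ⊢
      tauto
    have h1 := ih hl' (FreeGroup.mk [x] * r) (hx.mul hr)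
      (by rw [h, ← FreeGroup.mul_mk, mul_assoc])
    rw [List.length_append, List.length_singleton, Function.iterate_succ_apply', h1, mul_assoc,
      ht', inv_mul_cancel_left, gammaPlus, hxt]
    rw [← FreeGroup.mul_mk, map_mul, mul_assoc, ← mul_assoc q, ht', mk_cons x t]
    simp only [List.tail_cons, List.head?_cons, Option.toList_some]
    group

/-- If `v` is a prefix of `q φ(q) ⋯ φ^{n-1}(q)`, then iterating `gammaPlus` from `q` as many times
as `v` has letters yields `v⁻¹ q φ(v)`. -/
theorem gammaPlus_iterate {φ : MulAut (F N)} (hφ : IsPositive φ) {b : Bool} {q v r : F N}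
    (hq : Signed b q) (hv : Signed b v) (hr : Signed b r) {n : ℕ}
    (h : devWord φ (fun _ => q) n = v * r) :
    (gammaPlus φ)^[v.norm] q = v⁻¹ * q * φ v := by
  have := gammaPlus_iterate_mk hφ hq n v.toWord hv r hr (by rwa [FreeGroup.mk_toWord])
  rwa [FreeGroup.mk_toWord] at this

/-- Inversion reverses words and so exchanges the two maps. This is why `gammaPlus` is studied for
words of either sign. -/
theorem gammaMinus_eq (φ : MulAut (F N)) (u : F N) : gammaMinus φ u = (gammaPlus φ u⁻¹)⁻¹ := by
  rw [gammaMinus, gammaPlus, FreeGroup.toWord_inv]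
  rcases List.eq_nil_or_concat u.toWord with h | ⟨l, x, h⟩
  · simp [h, ← FreeGroup.one_eq_mk, FreeGroup.invRev]
  · have h1 : FreeGroup.invRev (l ++ [x]) = invLetter x :: FreeGroup.invRev l := by
      simp [FreeGroup.invRev, invLetter]
    rw [h, List.concat_eq_append, h1]
    simp only [List.dropLast_concat, List.tail_cons, List.head?_cons, Option.toList_some,
      List.getLast?_concat]
    rw [mul_inv_rev, mk_invLetter, map_inv, inv_inv, FreeGroup.inv_mk, FreeGroup.invRev_invRev]

theorem gammaMinus_iterate (φ : MulAut (F N)) (m : ℕ) (u : F N) :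
    (gammaMinus φ)^[m] u = ((gammaPlus φ)^[m] u⁻¹)⁻¹ := by
  induction m with
  | zero => simp
  | succ m ih => rw [Function.iterate_succ_apply', ih, gammaMinus_eq, inv_inv,
      Function.iterate_succ_apply']

end DevelopmentWord

/-! ### Comparing developments in one orbit, and fixed points. -/

section Development

variable {N : ℕ}

/-- `φ(a_{i+1})` begins with `p_i`, so the `|p_i|` letters removed by the shift spell `p_i`: the
shift is left multiplication by `p_i⁻¹`. -/
theorem HasDevelopment.exists_lines {φ : MulAut (F N)} (hφ : IsPositive φ) {W : DoubleBoundary N}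
    {d : ℕ → Label N} (hd : HasDevelopment φ W d) : ∃ Z : ℕ → DoubleBoundary N, Z 0 = W ∧
      ∀ i, IsLine (Z i) ∧ (Z i).1.2.1 0 = ((d i).2.1, true) ∧
        Z i = doubleBoundaryMap (MulAut.conj (d i).1⁻¹ * φ) (Z (i + 1)) := by
  obtain ⟨had, Z, h0, hZ⟩ := hd
  refine ⟨Z, h0, fun i => ⟨isLine_of_mem hφ (hZ i).1, (hZ i).2.1, ?_⟩⟩
  have h1 : (Z (i + 1)).1.2.StartsWith (FreeGroup.of (d (i + 1)).2.1) := by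
    have := (Z (i + 1)).1.2.startsWith_letter
    rwa [(hZ (i + 1)).2.1] at this
  have h2 := h1.map hφ (signed_one true) (signed_of _) (isLine_of_mem hφ (hZ (i + 1)).1).2
  obtain ⟨hp, hs⟩ := had.signed hφ i
  rw [map_one, one_mul, one_mul, (had i).eq_mul, mul_assoc] at h2
  have h3 := h2.of_mul hp ((signed_of _).mul hs)
  have h4 := (hZ i).2.2
  rw [shift_iterate, ← doubleBoundaryMap_mul] at h4
  conv_lhs => rw [h4]
  congr 4

theorem doubleBoundaryMap_injective (ψ : MulAut (F N)) :
    Function.Injective (doubleBoundaryMap ψ) := by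
  intro Z Z' h
  have h1 := congrArg (doubleBoundaryMap ψ⁻¹) h
  simpa only [← doubleBoundaryMap_mul, inv_mul_cancel, doubleBoundaryMap_one] using h1

/-- The exponent sum. -/
def expSum : F N →* Multiplicative ℤ := FreeGroup.lift fun _ => Multiplicative.ofAdd 1

/-- Consequently conjugate signed words have equal length. -/
theorem Signed.natAbs_expSum {b : Bool} {g : F N} (hg : Signed b g) :
    (expSum g).toAdd.natAbs = g.norm := by
  have key : ∀ l : List (Letter N), (∀ x ∈ l, x.2 = b) →
      (expSum (FreeGroup.mk l : F N)).toAdd = if b then (l.length : ℤ) else -l.length := by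
    intro l hl
    induction l with
    | nil => simp [← FreeGroup.one_eq_mk]
    | cons x l ih =>
      rw [mk_cons, map_mul, toAdd_mul, ih fun y hy => hl y (by simp [hy])]
      have hx := hl x (by simp)
      obtain ⟨c, e⟩ := x
      simp only at hx
      subst hx
      cases e <;> simp [expSum, add_comm]
  have h := key g.toWord hg
  rw [FreeGroup.mk_toWord] at h
  rw [h, FreeGroup.norm]
  split_ifs <;> simp

/-- Desubstitution of two points of the same orbit, one of which has a constant development: when
the other development is eventually the same, the desubstituted points eventually coincide. -/
theorem devWord_eq_of_eventually_const (hN : 2 ≤ N) {φ : MulAut (F N)} (hφ : IsPositive φ)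
    (hprim : IsPrimitive φ) {Z Z' : ℕ → DoubleBoundary N} {σ : ℕ → F N} {p : F N} {n : ℕ}
    (hσ : ∀ i, n ≤ i → σ i = p) (hZ : ∀ i, IsLine (Z i)) (hZ' : ∀ i, IsLine (Z' i))
    (hrec : ∀ i, Z i = doubleBoundaryMap (MulAut.conj (σ i)⁻¹ * φ) (Z (i + 1)))
    (hrec' : ∀ i, Z' i = doubleBoundaryMap (MulAut.conj p⁻¹ * φ) (Z' (i + 1)))
    {k₀ : F N} (h0 : Z' 0 = doubleBoundaryMap (MulAut.conj k₀) (Z 0)) :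
    devWord φ (fun _ => p⁻¹) n = k₀ * devWord φ (fun i => (σ i)⁻¹) n := by
  -- The recursion is `p⁻¹ φ(k_{i+1}) = k_i σ_i⁻¹`, the condition for the `k_i` to intertwine the
  -- two desubstitutions.
  obtain ⟨k, hk0, hks⟩ : ∃ k : ℕ → F N, k 0 = k₀ ∧ ∀ i, φ (k (i + 1)) = p * k i * (σ i)⁻¹ :=
    ⟨fun i => Nat.rec k₀ (fun i k => φ⁻¹ (p * k * (σ i)⁻¹)) i, rfl,
      fun i => MulAut.apply_inv_self _ _ _⟩
  have hk : ∀ i, Z' i = doubleBoundaryMap (MulAut.conj (k i)) (Z i) := by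
    intro i
    induction i with
    | zero => rw [h0, hk0]
    | succ i ih =>
      apply doubleBoundaryMap_injective (MulAut.conj p⁻¹ * φ)
      rw [← hrec', ih, hrec, ← doubleBoundaryMap_mul, ← doubleBoundaryMap_mul, mul_assoc _ φ,
        mul_conj, hks, ← mul_assoc, ← mul_assoc, ← map_mul, ← map_mul, mul_assoc p,
        inv_mul_cancel_left]
  have hsig : ∀ i, ∃ b, Signed b (k i) := fun i => Signed.of_isLine (hZ i) (hk i ▸ hZ' i)
  have hconj : ∀ m, ∃ c, (φ ^ m) (k (n + m)) = c * k n * c⁻¹ := by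
    intro m
    induction m with
    | zero => exact ⟨1, by simp⟩
    | succ m ih =>
      obtain ⟨c, hc⟩ := ih
      refine ⟨(φ ^ m) p * c, ?_⟩
      rw [pow_succ, MulAut.mul_apply, ← add_assoc, hks, hσ _ (by omega), map_mul, map_mul, hc,
        map_inv]
      group
  -- Otherwise `φ^m(k_{n+m})` would have the length of `k_n` for every `m`, against growth.
  have hkn : k n = 1 := by
    by_contra hne
    obtain ⟨m, hm⟩ := IsPrimitive.exists_growth hN hφ hprim ((k n).norm + 1)
    obtain ⟨c, hc⟩ := hconj m
    obtain ⟨b, hb⟩ := hsig (n + m)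
    obtain ⟨b', hb'⟩ := hsig n
    have hne' : k (n + m) ≠ 1 := by
      intro h
      rw [h, map_one] at hc
      exact hne (conj_eq_one_iff.1 hc.symm)
    have h1 := hm m le_rfl b _ hb hne'
    have h2 : expSum (c * k n * c⁻¹) = expSum (k n) := by
      rw [map_mul, map_mul, map_inv, mul_inv_cancel_comm]
    rw [← ((hφ.pow m).signed_map hb).natAbs_expSum, hc, h2, hb'.natAbs_expSum] at h1
    omega
  -- Telescoping the recursion; at `i = n` the factor `φ^n(k_n)` disappears.
  have hinv : ∀ i, devWord φ (fun _ => p⁻¹) i * (φ ^ i) (k i) =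
      k₀ * devWord φ (fun i => (σ i)⁻¹) i := by
    intro i
    induction i with
    | zero => simp [devWord_zero, hk0]
    | succ i ih =>
      rw [devWord_succ, devWord_succ, ← mul_assoc, ← ih, pow_succ, MulAut.mul_apply, hks]
      simp only [map_mul, map_inv]
      group
  have := hinv n
  rwa [hkn, map_one, mul_one] at this

/-- A point with a constant development is periodic under `∂²(i_p ∘ φ)`. -/
theorem exists_pow_fixed_of_const (hN : 2 ≤ N) {φ : MulAut (F N)} (hφ : IsPositive φ)
    (hprim : IsPrimitive φ) {p s : F N} {a : Fin N} (hp : Signed true p) (hs : Signed true s)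
    (hpas : φ (FreeGroup.of a) = p * FreeGroup.of a * s) {Z : ℕ → DoubleBoundary N}
    (hZ : ∀ i, IsLine (Z i)) (ha : ∀ i, (Z i).1.2.1 0 = (a, true))
    (hrec : ∀ i, Z i = doubleBoundaryMap (MulAut.conj p⁻¹ * φ) (Z (i + 1))) :
    ∃ h, 1 ≤ h ∧ doubleBoundaryMap ((MulAut.conj p⁻¹ * φ) ^ h) (Z 0) = Z 0 := by
  have hiter : ∀ m, Z 0 = doubleBoundaryMap ((MulAut.conj p⁻¹ * φ) ^ m) (Z m) := by
    intro m
    induction m with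
    | zero => rw [pow_zero, doubleBoundaryMap_one]
    | succ m ih => rw [pow_succ, doubleBoundaryMap_mul, ← hrec, ← ih]
  obtain ⟨h₁, hh₁, hper₁⟩ := exists_periodic_of_signed hN hφ hprim hp.inv
    (fun i => (Z i).1.1) (fun i => (hZ i).1)
    (fun i => congrArg (fun Z : DoubleBoundary N => Z.1.1) (hrec i))
  -- On the positive half `p⁻¹` cancels. Removing the leading `a` restores a recursion of one sign,
  -- since `a⁻¹ p⁻¹ φ(a) = s`.
  obtain ⟨h₂, hh₂, hper₂⟩ := exists_periodic_of_signed hN hφ hprim hs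
    (fun i => boundaryMap (MulAut.conj (FreeGroup.of a)⁻¹) (Z i).1.2)
    (fun i => by
      have h1 : FreeGroup.of a = (Z i).1.2.pre 1 := by
        simp [Boundary.pre, ha, FreeGroup.of]
      intro t
      rw [h1, boundaryMap_conj_inv_pre]
      exact (hZ i).2 _)
    (fun i => by
      have h1 : (Z i).1.2 = boundaryMap (MulAut.conj p⁻¹ * φ) (Z (i + 1)).1.2 :=
        congrArg (fun Z : DoubleBoundary N => Z.1.2) (hrec i)
      rw [h1, ← boundaryMap_mul, ← boundaryMap_mul, mul_assoc _ φ, mul_conj, map_inv φ, hpas]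
      congr 1
      rw [← mul_assoc, ← mul_assoc, ← map_mul, ← map_mul]
      congr 2
      group)
  refine ⟨h₁ * h₂, Nat.mul_pos hh₁ hh₂, ?_⟩
  have e1 : (Z (h₁ * h₂)).1.1 = (Z 0).1.1 := by
    have := (hper₁.nat_mul h₂) 0
    simpa [mul_comm] using this
  have e2 : (Z (h₁ * h₂)).1.2 = (Z 0).1.2 := by
    have := (hper₂.nat_mul h₁) 0
    exact boundaryMap_injective _ (by simpa using this)
  have e3 : Z (h₁ * h₂) = Z 0 := Subtype.ext (Prod.ext e1 e2)
  have := hiter (h₁ * h₂)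
  rw [e3] at this
  exact this.symm

theorem exists_pow_fixed_of_conj {ψ : MulAut (F N)} {V W : DoubleBoundary N} {k : F N}
    (hV : V = doubleBoundaryMap (MulAut.conj k) W) {h : ℕ}
    (hfix : doubleBoundaryMap (ψ ^ h) V = V) :
    doubleBoundaryMap (((MulAut.conj k)⁻¹ * ψ * MulAut.conj k) ^ h) W = W := by
  have h1 : ((MulAut.conj k)⁻¹ * ψ * MulAut.conj k) ^ h =
      (MulAut.conj k)⁻¹ * ψ ^ h * MulAut.conj k := by
    have := conj_pow (i := h) (a := (MulAut.conj k)⁻¹) (b := ψ)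
    rwa [inv_inv] at this
  rw [h1, doubleBoundaryMap_mul, doubleBoundaryMap_mul, ← hV, hfix, hV, ← doubleBoundaryMap_mul,
    inv_mul_cancel, doubleBoundaryMap_one]

end Development

end PrefixSuffix

/-! ### The fixed point and its conjugating word. -/

theorem mainTheorem9 (N : ℕ) (hN : 2 ≤ N) (φ : MulAut (F N)) (hpos : IsPositive φ)
    (hprim : IsPrimitive φ) (W : DoubleBoundary N) (hW : W ∈ attractingSubshift φ)
    (d : ℕ → Label N) (n : ℕ) (p : F N) (a : Fin N) (s : F N)
    (hd : HasDevelopment φ W d) (hconst : ∀ i, n ≤ i → d i = (p, a, s))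
    (j : ℤ) (hj : HasDevelopment φ (shiftPow j W) (fun _ => (p, a, s))) :
    ∃ w : F N,
      (∃ h : ℕ, 1 ≤ h ∧ doubleBoundaryMap ((innerAut w * φ) ^ h) W = W) ∧
      (0 ≤ j → w = (gammaMinus φ)^[j.natAbs] p) ∧
      (j < 0 → w⁻¹ = (gammaPlus φ)^[j.natAbs - 1] s) := by
  have hline := isLine_of_mem hpos hW
  obtain ⟨Z, hZ0, hZ⟩ := hd.exists_lines hpos
  obtain ⟨Z', hZ0', hZ'⟩ := hj.exists_lines hpos
  obtain ⟨hp, hs⟩ : Signed true p ∧ Signed true s := hj.1.signed hpos 0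
  have hpas : φ (FreeGroup.of a) = p * FreeGroup.of a * s := (hj.1 0).eq_mul
  have hsig := hd.1.signed hpos
  -- `k⁻¹` consists of the first `|j|` letters of the positive half of `W` if `j ≥ 0`, and of the
  -- negative half if `j < 0`.
  obtain ⟨k, hVk, hk⟩ : ∃ k, shiftPow j W = doubleBoundaryMap (MulAut.conj k) W ∧
      k.norm = j.natAbs ∧ (0 ≤ j → Signed false k) ∧ (j < 0 → Signed true k) := by
    by_cases hj0 : 0 ≤ j
    · refine ⟨(W.1.2.pre j.natAbs)⁻¹, by rw [shiftPow, if_pos hj0, shift_iterate], ?_,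
        fun _ => (hline.2.pre _).inv, fun h => absurd hj0 (by omega)⟩
      rw [FreeGroup.norm_inv_eq, Boundary.norm_pre]
    · refine ⟨(W.1.1.pre j.natAbs)⁻¹, by rw [shiftPow, if_neg hj0, shiftInv_iterate], ?_,
        fun h => absurd h hj0, fun _ => (hline.1.pre _).inv⟩
      rw [FreeGroup.norm_inv_eq, Boundary.norm_pre]
  obtain ⟨hknorm, hkneg, hkpos⟩ := hk
  have hdev := devWord_eq_of_eventually_const hN hpos hprim (Z := Z) (Z' := Z')
    (σ := fun i => (d i).1) (p := p) (n := n) (fun i hi => by rw [hconst i hi])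
    (fun i => (hZ i).1) (fun i => (hZ' i).1) (fun i => (hZ i).2.2) (fun i => (hZ' i).2.2)
    (k₀ := k) (by rw [hZ0, hZ0', hVk])
  obtain ⟨h, hh, hfix⟩ := exists_pow_fixed_of_const hN hpos hprim hp hs hpas
    (fun i => (hZ' i).1) (fun i => (hZ' i).2.1) (fun i => (hZ' i).2.2)
  rw [hZ0'] at hfix
  refine ⟨(k⁻¹ * p⁻¹ * φ k)⁻¹, ⟨h, hh, ?_⟩, fun hj0 => ?_, fun hj0 => ?_⟩
  · have h1 := exists_pow_fixed_of_conj hVk hfix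
    rw [mul_assoc _ _ (MulAut.conj k), mul_assoc _ φ, mul_conj, ← map_inv, ← mul_assoc,
      ← mul_assoc, ← map_mul, ← map_mul] at h1
    rw [innerAut, inv_inv]
    exact h1
  -- All words in `hdev` are negative, so it exhibits `k` as a prefix of `p⁻¹ φ(p⁻¹) ⋯`.
  · rw [gammaMinus_iterate, ← hknorm, gammaPlus_iterate hpos hp.inv (hkneg hj0)
      (devWord_signed hpos (fun i => (hsig i).1.inv) n) hdev]
  · have hkt := hkpos hj0
    have e1 := hd.1.pow_apply n
    have e2 := hj.1.pow_apply n
    have hS' := devWord_signed hpos (fun i => (hsig i).2) n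
    have hS := devWord_signed hpos (σ := fun _ => s) (fun _ => hs) n
    rw [hconst n le_rfl] at e1
    dsimp only at e1 e2
    rw [e2, hdev] at e1
    set S := devWord φ (fun _ => s) n
    set S' := devWord φ (fun i => (d i).2.2) n
    -- Both developments have the letter `a` at index `n`, so they factor the same word `φ^n(a)`.
    -- Cancelling the prefix parts through `hdev` leaves an equality of positive words.
    have e3 : FreeGroup.of a * S = k * (FreeGroup.of (d 0).2.1 * S') := by
      rw [mul_inv_rev, mul_assoc, mul_assoc, mul_assoc, mul_right_inj, inv_mul_eq_iff_eq_mul] at e1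
      exact e1
    have e4 := congrArg FreeGroup.toWord e3
    rw [(signed_of a).toWord_mul hS, hkt.toWord_mul ((signed_of _).mul hS'),
      FreeGroup.toWord_of] at e4
    obtain ⟨y, l, hl⟩ : ∃ y l, k.toWord = y :: l := by
      apply List.exists_cons_of_ne_nil
      intro h
      rw [FreeGroup.norm, h] at hknorm
      simp at hknorm
      omega
    rw [hl, List.singleton_append, List.cons_append, List.cons.injEq] at e4
    -- So `k` starts with `a`. The remaining `|j| - 1` letters form a prefix `l` of `s φ(s) ⋯`, and
    -- `k⁻¹ p⁻¹ φ(k) = l⁻¹ s φ(l)`.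
    obtain ⟨rfl, e5⟩ := e4
    have hk : k = FreeGroup.of a * FreeGroup.mk l := by
      rw [← FreeGroup.mk_toWord (x := k), hl, mk_cons, FreeGroup.of]
    have hlsig : ∀ x ∈ l, x.2 = true := fun x hx => hkt x (by rw [hl]; simp [hx])
    have e6 : S = FreeGroup.mk l * (FreeGroup.of (d 0).2.1 * S') := by
      rw [hk, mul_assoc, mul_right_inj] at e3
      exact e3
    have hlen : j.natAbs - 1 = (FreeGroup.mk l : F N).norm := by
      rw [norm_mk_of_isReduced (isReduced_of_sign hlsig), ← hknorm, FreeGroup.norm, hl]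
      simp
    rw [hlen, gammaPlus_iterate hpos hs (signed_mk hlsig) ((signed_of _).mul hS') e6, inv_inv, hk,
      map_mul, hpas]
    group
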